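/- Let $k$ be an algebraically closed field of characteristic $p>0$ and let $G$ be a finite unipotent group scheme over $k$, that is, an affine group scheme whose coordinate ring $k[G]$ has finite dimension over $k$ and for which every nonzero finite-dimensional representation has a nonzero fixed vector. Let $kG=\operatorname{Hom}_k(k[G],k)$ be its group algebra, with the Hopf algebra structure dual to that of $k[G]$. A finite-dimensional $kG$-module $M$ is called endotrivial if $\operatorname{Hom}_k(M,M)\cong k\oplus P$ as $kG$-modules for some projective $kG$-module $P$; here $k$ is the trivial module and $h\in kG$ acts on $\operatorname{Hom}_k(M,M)$ by $(hf)(m)=\sum h_{(1)}f(S(h_{(2)})m)$, where $S$ is the antipode of $kG$. Then for every positive integer $n$ there are, up to isomorphism, only finitely many endotrivial $kG$-modules $M$ with $\dim_k M=n$. -/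

import Mathlib

open TensorProduct Coalgebra AlgebraicGeometry CategoryTheory

universe u v w

noncomputable section

namespace FinGroupScheme

/-! ## The group algebra: the linear dual of the coordinate ring, as a Hopf algebra -/

/-- The linear dual of a Hopf algebra `A`, with the convolution product
`(f * g)(a) = ∑ f a₍₁₎ * g a₍₂₎`. If `A = k[G]`, this is the group algebra `kG`. -/
def GroupAlg (k : Type u) (A : Type v) [Field k] [Ring A] [HopfAlgebra k A] : Type (max u v) :=
  WithConv (A →ₗ[k] k)

namespace GroupAlg

variable (k : Type u) (A : Type v) [Field k] [Ring A] [HopfAlgebra k A]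

instance : Ring (GroupAlg k A) := inferInstanceAs (Ring (WithConv (A →ₗ[k] k)))

instance : Algebra k (GroupAlg k A) := inferInstanceAs (Algebra k (WithConv (A →ₗ[k] k)))

/-- The identification of `kG` with the linear dual of `A`, forgetting the product. -/
def toDual : GroupAlg k A ≃ₗ[k] Module.Dual k A where
  toFun f := WithConv.ofConv f
  invFun f := WithConv.toConv f
  map_add' _ _ := rfl
  map_smul' _ _ := rfl
  left_inv _ := rfl
  right_inv _ := rfl

lemma toDual_one (a : A) : toDual k A 1 a = counit (R := k) a := rfl

lemma toDual_mul (f g : GroupAlg k A) {ι : Type*} {a : A} (r : Coalgebra.Repr k a ι) :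
    toDual k A (f * g) a = ∑ i ∈ r.index, toDual k A f (r.left i) * toDual k A g (r.right i) :=
  r.convMul_apply (A := k) f g

variable [Module.Finite k A]

instance : Module.Finite k (GroupAlg k A) := Module.Finite.equiv (toDual k A).symm

/-- For finite-dimensional `A` the pairing `⟨f ⊗ g, a ⊗ b⟩ = f a * g b` identifies `kG ⊗ kG`
with the dual of `A ⊗ A`. -/
def pair : (GroupAlg k A ⊗[k] GroupAlg k A) ≃ₗ[k] Module.Dual k (A ⊗[k] A) :=
  (TensorProduct.congr (toDual k A) (toDual k A)).trans (TensorProduct.dualDistribEquiv k A A)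

lemma pair_tmul (f g : GroupAlg k A) (a b : A) :
    pair k A (f ⊗ₜ g) (a ⊗ₜ b) = toDual k A f a * toDual k A g b := rfl

/-- The comultiplication of `kG` is the transpose of the multiplication of `A`, so that
`∑ f₍₁₎ a * f₍₂₎ b = f (a * b)`; the counit is evaluation at `1`. -/
instance : CoalgebraStruct k (GroupAlg k A) where
  comul := (pair k A).symm.toLinearMap ∘ₗ (LinearMap.mul' k A).dualMap ∘ₗ
    (toDual k A).toLinearMap
  counit := LinearMap.applyₗ (1 : A) ∘ₗ (toDual k A).toLinearMap

lemma counit_apply (f : GroupAlg k A) : counit (R := k) f = toDual k A f 1 := rfl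

lemma pair_comul (f : GroupAlg k A) :
    pair k A (comul (R := k) f) = toDual k A f ∘ₗ LinearMap.mul' k A :=
  (pair k A).apply_symm_apply _

lemma pair_comul_tmul (f : GroupAlg k A) (a b : A) :
    pair k A (comul (R := k) f) (a ⊗ₜ b) = toDual k A f (a * b) := by
  rw [pair_comul]; rfl

lemma sum_repr {ι : Type*} {f : GroupAlg k A} (r : Coalgebra.Repr k f ι) (a b : A) :
    ∑ i ∈ r.index, toDual k A (r.left i) a * toDual k A (r.right i) b = toDual k A f (a * b) := by
  rw [← pair_comul_tmul, ← r.eq]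
  simp [map_sum, LinearMap.sum_apply, pair_tmul]

/-- The threefold analogue of `pair`, used for coassociativity. -/
def pair₃ : (GroupAlg k A ⊗[k] (GroupAlg k A ⊗[k] GroupAlg k A)) ≃ₗ[k]
    Module.Dual k (A ⊗[k] (A ⊗[k] A)) :=
  (TensorProduct.congr (toDual k A) (pair k A)).trans
    (TensorProduct.dualDistribEquiv k A (A ⊗[k] A))

lemma pair₃_tmul (f : GroupAlg k A) (x : GroupAlg k A ⊗[k] GroupAlg k A)
    (a : A) (y : A ⊗[k] A) :
    pair₃ k A (f ⊗ₜ x) (a ⊗ₜ y) = toDual k A f a * pair k A x y := rfl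

lemma pair₃_assoc (x : GroupAlg k A ⊗[k] GroupAlg k A) (g : GroupAlg k A) (a b c : A) :
    pair₃ k A (TensorProduct.assoc k _ _ _ (x ⊗ₜ g)) (a ⊗ₜ (b ⊗ₜ c)) =
      pair k A x (a ⊗ₜ b) * toDual k A g c := by
  induction x with
  | zero => simp
  | tmul f h => simp [pair₃_tmul, pair_tmul, mul_assoc]
  | add x y hx hy => simp [add_tmul, add_mul, hx, hy]

instance : Coalgebra k (GroupAlg k A) where
  coassoc := by
    refine LinearMap.ext fun f => (pair₃ k A).injective ?_
    refine TensorProduct.ext_threefold' fun a b c => ?_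
    obtain ⟨r⟩ : Nonempty (Coalgebra.Repr k f _) := ⟨Coalgebra.Repr.arbitrary k f⟩
    simp only [LinearMap.comp_apply, LinearEquiv.coe_coe]
    rw [← r.eq]
    simp only [map_sum, LinearMap.sum_apply, LinearMap.rTensor_tmul, LinearMap.lTensor_tmul,
      pair₃_assoc, pair₃_tmul, pair_comul_tmul]
    rw [sum_repr, sum_repr, mul_assoc]
  rTensor_counit_comp_comul := by
    refine LinearMap.ext fun f => ((TensorProduct.lid k _).trans (toDual k A)).injective ?_
    obtain ⟨r⟩ : Nonempty (Coalgebra.Repr k f _) := ⟨Coalgebra.Repr.arbitrary k f⟩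
    simp only [LinearMap.comp_apply]
    rw [← r.eq]
    refine LinearMap.ext fun a => ?_
    have := sum_repr k A r 1 a
    rw [one_mul] at this
    simpa [map_sum, LinearMap.sum_apply, counit_apply] using this
  lTensor_counit_comp_comul := by
    refine LinearMap.ext fun f => ((TensorProduct.rid k _).trans (toDual k A)).injective ?_
    obtain ⟨r⟩ : Nonempty (Coalgebra.Repr k f _) := ⟨Coalgebra.Repr.arbitrary k f⟩
    simp only [LinearMap.comp_apply]
    rw [← r.eq]
    refine LinearMap.ext fun a => ?_
    have := sum_repr k A r a 1
    rw [mul_one] at this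
    simpa [map_sum, LinearMap.sum_apply, counit_apply, mul_comm] using this

lemma pair_mul (x y : GroupAlg k A ⊗[k] GroupAlg k A) {ι κ : Type*} {a b : A}
    (ra : Coalgebra.Repr k a ι) (rb : Coalgebra.Repr k b κ) :
    pair k A (x * y) (a ⊗ₜ b) = ∑ i ∈ ra.index, ∑ j ∈ rb.index,
      pair k A x (ra.left i ⊗ₜ rb.left j) * pair k A y (ra.right i ⊗ₜ rb.right j) := by
  induction x with
  | zero => simp
  | add x x' hx hx' => simp [add_mul, hx, hx', Finset.sum_add_distrib]
  | tmul f g =>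
    induction y with
    | zero => simp
    | add y y' hy hy' => simp [mul_add, hy, hy', Finset.sum_add_distrib]
    | tmul f' g' =>
      rw [Algebra.TensorProduct.tmul_mul_tmul, pair_tmul, toDual_mul k A _ _ ra,
        toDual_mul k A _ _ rb, Finset.sum_mul_sum]
      refine Finset.sum_congr rfl fun i _ => Finset.sum_congr rfl fun j _ => ?_
      rw [pair_tmul, pair_tmul]
      ring

instance : Bialgebra k (GroupAlg k A) :=
  Bialgebra.mk' k (GroupAlg k A)
    (by simp [counit_apply, toDual_one])
    (by
      intro f g
      rw [counit_apply, counit_apply, counit_apply]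
      have h : toDual k A (f * g) 1 = LinearMap.mul' k k
        (TensorProduct.map (toDual k A f) (toDual k A g) (comul (R := k) (1 : A))) := rfl
      rw [h]
      simp [Algebra.TensorProduct.one_def])
    (by
      refine (pair k A).injective (TensorProduct.ext' fun a b => ?_)
      rw [pair_comul_tmul, Algebra.TensorProduct.one_def, pair_tmul]
      simp [toDual_one])
    (by
      intro f g
      refine (pair k A).injective (TensorProduct.ext' fun a b => ?_)
      let ra := Coalgebra.Repr.arbitrary k a
      let rb := Coalgebra.Repr.arbitrary k b
      rw [pair_mul k A _ _ ra rb, pair_comul_tmul, toDual_mul k A _ _ (ra.mul rb)]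
      simp only [pair_comul_tmul]
      exact Finset.sum_product _ _ _)

/-- The antipode of `kG` is the transpose of the antipode of `A`. -/
instance : HopfAlgebra k (GroupAlg k A) where
  antipode := (toDual k A).symm.toLinearMap ∘ₗ (HopfAlgebra.antipode k (A := A)).dualMap ∘ₗ
    (toDual k A).toLinearMap
  mul_antipode_rTensor_comul := by
    refine LinearMap.ext fun f => (toDual k A).injective (LinearMap.ext fun a => ?_)
    obtain ⟨r⟩ : Nonempty (Coalgebra.Repr k f _) := ⟨Coalgebra.Repr.arbitrary k f⟩
    let ra := Coalgebra.Repr.arbitrary k a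
    simp only [LinearMap.comp_apply]
    rw [← r.eq]
    simp only [map_sum, LinearMap.sum_apply, LinearMap.rTensor_tmul, LinearMap.mul'_apply,
      toDual_mul k A _ _ ra]
    rw [Finset.sum_comm]
    have h : ∀ j, ∑ i ∈ r.index, toDual k A (r.left i) (HopfAlgebra.antipode k (ra.left j)) *
        toDual k A (r.right i) (ra.right j) =
        toDual k A f (HopfAlgebra.antipode k (ra.left j) * ra.right j) :=
      fun j => sum_repr k A r _ _
    refine (Finset.sum_congr rfl fun j _ => h j).trans ?_
    rw [← map_sum, HopfAlgebra.sum_antipode_mul_eq_smul, map_smul, counit_apply,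
      Algebra.linearMap_apply, Algebra.algebraMap_eq_smul_one, map_smul, LinearMap.smul_apply,
      toDual_one, smul_eq_mul, smul_eq_mul, mul_comm]
  mul_antipode_lTensor_comul := by
    refine LinearMap.ext fun f => (toDual k A).injective (LinearMap.ext fun a => ?_)
    obtain ⟨r⟩ : Nonempty (Coalgebra.Repr k f _) := ⟨Coalgebra.Repr.arbitrary k f⟩
    let ra := Coalgebra.Repr.arbitrary k a
    simp only [LinearMap.comp_apply]
    rw [← r.eq]
    simp only [map_sum, LinearMap.sum_apply, LinearMap.lTensor_tmul, LinearMap.mul'_apply,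
      toDual_mul k A _ _ ra]
    rw [Finset.sum_comm]
    have h : ∀ j, ∑ i ∈ r.index, toDual k A (r.left i) (ra.left j) *
        toDual k A (r.right i) (HopfAlgebra.antipode k (ra.right j)) =
        toDual k A f (ra.left j * HopfAlgebra.antipode k (ra.right j)) :=
      fun j => sum_repr k A r _ _
    refine (Finset.sum_congr rfl fun j _ => h j).trans ?_
    rw [← map_sum, HopfAlgebra.sum_mul_antipode_eq_smul, map_smul, counit_apply,
      Algebra.linearMap_apply, Algebra.algebraMap_eq_smul_one, map_smul, LinearMap.smul_apply,
      toDual_one, smul_eq_mul, smul_eq_mul, mul_comm]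

end GroupAlg

/-! ## Modules over a Hopf algebra -/

/-- The ground field with the trivial action `h • c = ε(h) c` of a Hopf algebra `H`. -/
def TrivialMod (k : Type u) (H : Type v) [Field k] [Ring H] [HopfAlgebra k H] : Type u := k

namespace TrivialMod

variable (k : Type u) (H : Type v) [Field k] [Ring H] [HopfAlgebra k H]

instance : AddCommGroup (TrivialMod k H) := inferInstanceAs (AddCommGroup k)

instance : Module H (TrivialMod k H) :=
  Module.compHom k (Bialgebra.counitAlgHom k H).toRingHom

end TrivialMod

/-- The space `Hom_k(M, N)` of all `k`-linear maps between two modules over a Hopf algebra `H`,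
with the action `(h • f)(m) = ∑ h₍₁₎ • f (S(h₍₂₎) • m)`. -/
def HomMod (k : Type u) (H : Type v) (M N : Type w) [Field k] [Ring H] [HopfAlgebra k H]
    [AddCommGroup M] [Module k M] [AddCommGroup N] [Module k N] : Type w :=
  M →ₗ[k] N

namespace HomMod

variable (k : Type u) (H : Type v) (M N : Type w) [Field k] [Ring H] [HopfAlgebra k H]
  [AddCommGroup M] [Module k M] [Module H M] [IsScalarTower k H M]
  [AddCommGroup N] [Module k N] [Module H N] [IsScalarTower k H N]

instance : AddCommGroup (HomMod k H M N) := inferInstanceAs (AddCommGroup (M →ₗ[k] N))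

/-- The action of `H` on `Hom_k(M, N)` through the target: `f ↦ (m ↦ h • f m)`. -/
def actTarget : H →ₐ[k] Module.End k (M →ₗ[k] N) :=
  AlgHom.ofLinearMap
    (LinearMap.llcomp k M N N ∘ₗ (Algebra.lsmul k k N).toLinearMap)
    (by ext f m; simp) (by intro a b; ext f m; simp)

/-- The action of `H` on `Hom_k(M, N)` through the source: `f ↦ (m ↦ f (S(h) • m))`. -/
def actSource : H →ₐ[k] Module.End k (M →ₗ[k] N) :=
  AlgHom.ofLinearMap
    ((LinearMap.llcomp k M M N).flip ∘ₗ (Algebra.lsmul k k M).toLinearMap ∘ₗ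
      HopfAlgebra.antipode k (A := H))
    (by ext f m; simp)
    (by intro a b; ext f m; simp [HopfAlgebra.antipode_mul_antidistrib])

/-- The action of `H` on `Hom_k(M, N)`: `h` acts as `∑ actTarget h₍₁₎ * actSource h₍₂₎`. -/
def act : H →ₐ[k] Module.End k (M →ₗ[k] N) :=
  (Algebra.TensorProduct.lift (actTarget k H M N) (actSource k H M N)
    (by intro a b; ext f m; simp [actTarget, actSource])).comp (Bialgebra.comulAlgHom k H)

instance : Module H (HomMod k H M N) :=
  Module.compHom (M →ₗ[k] N) (act k H M N).toRingHom

/-- A `k`-linear map, seen as an element of the `H`-module `Hom_k(M, N)`. -/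
def of : (M →ₗ[k] N) ≃+ HomMod k H M N := AddEquiv.refl _

lemma smul_apply (h : H) {ι : Type*} (r : Coalgebra.Repr k h ι) (f : M →ₗ[k] N) (m : M) :
    (of k H M N).symm (h • of k H M N f) m =
      ∑ i ∈ r.index, r.left i • f (HopfAlgebra.antipode k (r.right i) • m) := by
  change act k H M N h f m = _
  simp only [act, AlgHom.comp_apply, Bialgebra.comulAlgHom_apply]
  rw [← r.eq]
  simp [map_sum, LinearMap.sum_apply, actTarget, actSource]

end HomMod

/-- A finite-dimensional module `M` over a Hopf algebra `H` is endotrivial if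
`Hom_k(M, M) ≅ k ⊕ P` as `H`-modules for some projective `H`-module `P`. -/
def IsEndotrivial (k : Type u) (H : Type v) (M : Type w) [Field k] [Ring H] [HopfAlgebra k H]
    [AddCommGroup M] [Module k M] [Module H M] [IsScalarTower k H M] : Prop :=
  Module.Finite k M ∧
    ∃ (P : Type w) (_ : AddCommGroup P) (_ : Module H P), Module.Projective H P ∧
      Nonempty (HomMod k H M M ≃ₗ[H] TrivialMod k H × P)

/-! ## Finite group schemes -/

/-- The coordinate ring `k[G]` of an affine group scheme `G` over a field `k`. -/
def CoordRing (k : Type u) [Field k] (G : Scheme.{u}) : Type u := Γ(G, ⊤)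

namespace CoordRing

variable (k : Type u) [Field k] (G : Scheme.{u})

instance : CommRing (CoordRing k G) := inferInstanceAs (CommRing Γ(G, ⊤))

/-- Mathlib's Hopf algebra structure on the global sections of an affine group scheme. -/
abbrev hopfAlgebraΓ (R : CommRingCat.{u}) (X : Scheme.{u}) [X.Over (Spec R)]
    [GrpObj (X.asOver (Spec R))] [IsAffine X] : HopfAlgebra R Γ(X, ⊤) :=
  inferInstance

/-- The Hopf algebra structure on `k[G]` that corresponds to the group structure of `G`. -/
instance [G.Over (Spec (.of k))] [GrpObj (G.asOver (Spec (.of k)))] [IsAffine G] :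
    HopfAlgebra k (CoordRing k G) :=
  hopfAlgebraΓ (.of k) G

end CoordRing

/-- The group algebra `kG` of a finite group scheme `G`: the dual of its coordinate ring. -/
abbrev GroupSchemeAlg (k : Type u) [Field k] (G : Scheme.{u}) [G.Over (Spec (.of k))]
    [GrpObj (G.asOver (Spec (.of k)))] [IsAffine G] : Type u :=
  GroupAlg k (CoordRing k G)

/-- A finite group scheme `G` is unipotent if every nonzero finite-dimensional representation
(that is, `kG`-module) `V` has a nonzero fixed vector. -/
def IsUnipotent (k : Type u) [Field k] (G : Scheme.{u}) [G.Over (Spec (.of k))]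
    [GrpObj (G.asOver (Spec (.of k)))] [IsAffine G] [Module.Finite k (CoordRing k G)] : Prop :=
  ∀ (V : Type u) [AddCommGroup V] [Module k V] [Module (GroupSchemeAlg k G) V]
    [IsScalarTower k (GroupSchemeAlg k G) V] [Module.Finite k V] [Nontrivial V],
    ∃ v : V, v ≠ 0 ∧ ∀ h : GroupSchemeAlg k G, h • v = counit (R := k) h • v

end FinGroupScheme

end

open FinGroupScheme

namespace FinGroupScheme

/-! ## Cocommutative Hopf algebras -/

/-! Write H = kG. It is finite-dimensional, cocommutative because k[G] is commutative, and local
because G is unipotent. The theorem follows from a rigidity statement for endotrivial modules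
together with Hilbert's basis theorem.

If M is endotrivial, Hom_k(M, M) contains a free submodule of some rank r and codimension one
(`IsEndotrivial.exists_free`). Let N have the same dimension as M, and identify the two as vector
spaces. The free generators, read as maps M → N, still generate a free submodule of Hom_k(M, N)
whenever a certain determinant, a polynomial in the structure constants of N, does not vanish. Over
the Frobenius algebra H this submodule splits off, and locality makes the one-dimensional complement
trivial (`HasFixedVectors.exists_fixed_add_free`). The isomorphism Hom_k(M, M) ⊗ N ≅ Hom_k(M, N) ⊗ M
of `homTensSwap` then becomes N ⊕ F ≅ M ⊕ F with F free of finite rank, and cancellation gives N ≅ M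
(`HasFixedVectors.nonempty_equiv`).

So every endotrivial M has a principal open neighbourhood, in the affine space of structure
constants, in which all modules are isomorphic to M (`IsEndotrivial.exists_polynomial`). The
polynomial ring is Noetherian, so finitely many such open sets cover all endotrivial modules of
dimension n. -/

instance GroupAlg.instIsCocomm (k : Type u) (A : Type v) [Field k] [CommRing A] [HopfAlgebra k A]
    [Module.Finite k A] : IsCocomm k (GroupAlg k A) where
  comm_comp_comul := by
    refine LinearMap.ext fun f => (GroupAlg.pair k A).injective (TensorProduct.ext' fun a b => ?_)
    have h : ∀ x : GroupAlg k A ⊗[k] GroupAlg k A,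
        GroupAlg.pair k A (TensorProduct.comm k _ _ x) (a ⊗ₜ b) =
          GroupAlg.pair k A x (b ⊗ₜ a) := by
      intro x
      induction x with
      | zero => simp
      | tmul f g => simp [GroupAlg.pair_tmul, mul_comm]
      | add x y hx hy => simp [hx, hy]
    refine (h _).trans ?_
    rw [GroupAlg.pair_comul_tmul, GroupAlg.pair_comul_tmul, mul_comm]

section Sweedler

variable {k : Type*} {H : Type*} {W : Type*} [Field k] [Ring H] [HopfAlgebra k H]
  [AddCommGroup W] [Module k W]

lemma sum_counit_right_smul {ι : Type*} {h : H} (r : Coalgebra.Repr k h ι) :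
    ∑ i ∈ r.index, counit (R := k) (r.right i) • r.left i = h := by
  have := congrArg (TensorProduct.rid k H) (Coalgebra.sum_tmul_counit_eq r)
  rw [map_sum] at this
  simpa only [TensorProduct.rid_tmul, one_smul] using this

/-- The coproduct of `h` with its two factors exchanged. -/
@[simps]
def reprSwap [IsCocomm k H] {ι : Type*} {h : H} (r : Coalgebra.Repr k h ι) :
    Coalgebra.Repr k h ι where
  index := r.index
  left := r.right
  right := r.left
  eq := by
    rw [← comm_comul k h, ← r.eq]
    simp [map_sum]

/-- Coassociativity for a trilinear expression. -/
lemma sum_repr_assoc {ι : Type*} {κ μ : ι → Type*} {h : H} (r : Coalgebra.Repr k h ι)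
    (r₁ : ∀ i, Coalgebra.Repr k (r.left i) (κ i)) (r₂ : ∀ i, Coalgebra.Repr k (r.right i) (μ i))
    (T : H → H → H → W) (h₁ : ∀ b c, IsLinearMap k (T · b c))
    (h₂ : ∀ a c, IsLinearMap k (T a · c)) (h₃ : ∀ a b, IsLinearMap k (T a b ·)) :
    ∑ i ∈ r.index, ∑ j ∈ (r₁ i).index, T ((r₁ i).left j) ((r₁ i).right j) (r.right i) =
      ∑ i ∈ r.index, ∑ j ∈ (r₂ i).index, T (r.left i) ((r₂ i).left j) ((r₂ i).right j) := by
  let T₂ : H → H →ₗ[k] H →ₗ[k] W := fun a => LinearMap.mk₂ k (T a)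
    (fun x y c => (h₂ a c).map_add x y) (fun t x c => (h₂ a c).map_smul t x)
    (fun b => (h₃ a b).map_add) (fun t b => (h₃ a b).map_smul t)
  let T₁ : H →ₗ[k] (H ⊗[k] H) →ₗ[k] W :=
    { toFun := fun a => TensorProduct.lift (T₂ a)
      map_add' := fun x y => TensorProduct.ext' fun b c => by
        simpa [T₂] using (h₁ b c).map_add x y
      map_smul' := fun t x => TensorProduct.ext' fun b c => by
        simpa [T₂] using (h₁ b c).map_smul t x }
  have := congrArg (TensorProduct.lift T₁) (Coalgebra.sum_tmul_tmul_eq r r₁ r₂)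
  simpa [map_sum, T₁, T₂] using this

variable (k H)

/-- Evaluate ∑ S(S h₁) S(h₂) h₃ with both bracketings. Cocommutativity gives ∑ h₂ S(h₁) = ε(h), so
the first two factors collapse and leave h; the last two collapse and leave S(S h). -/
lemma antipode_antipode [IsCocomm k H] (h : H) :
    HopfAlgebra.antipode k (HopfAlgebra.antipode k h) = h := by
  let S := HopfAlgebra.antipode k (A := H)
  change S (S h) = h
  let r := ℛ k h
  have key := sum_repr_assoc r (fun i => ℛ k _) (fun i => ℛ k _)
    (fun a b c => S (S a) * S b * c)
    (fun b c => ⟨fun x y => by simp [add_mul], fun t x => by simp⟩)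
    (fun b c => ⟨fun x y => by simp [add_mul, mul_add], fun t x => by simp⟩)
    (fun b c => ⟨fun x y => by simp [mul_add], fun t x => by simp⟩)
  have e1 : ∀ i, ∑ j ∈ (ℛ k (r.left i)).index,
      S (S ((ℛ k (r.left i)).left j)) * S ((ℛ k (r.left i)).right j) * r.right i =
      (counit (R := k) (r.left i)) • r.right i := by
    intro i
    have h1 := HopfAlgebra.sum_mul_antipode_eq_smul (R := k) (reprSwap (ℛ k (r.left i)))
    have h2 := congrArg S h1
    rw [map_sum] at h2
    simp only [reprSwap_left, reprSwap_right, reprSwap_index, S,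
      HopfAlgebra.antipode_mul_antidistrib] at h2
    rw [← Finset.sum_mul]
    simp only [S]
    rw [h2]
    simp
  have e2 : ∀ i, ∑ j ∈ (ℛ k (r.right i)).index,
      S (S (r.left i)) * S ((ℛ k (r.right i)).left j) * (ℛ k (r.right i)).right j =
      (counit (R := k) (r.right i)) • S (S (r.left i)) := by
    intro i
    have h1 := HopfAlgebra.sum_antipode_mul_eq_smul (R := k) (ℛ k (r.right i))
    simp only [mul_assoc, ← Finset.mul_sum]
    simp only [S]
    rw [h1]
    simp
  simp only [e1, e2] at key
  rw [Coalgebra.sum_counit_smul r] at key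
  refine Eq.trans ?_ key.symm
  have := congrArg (S ∘ₗ S) (Coalgebra.sum_counit_smul (reprSwap r))
  simpa [map_sum] using this.symm

end Sweedler

/-! ## Tensor products of modules over a Hopf algebra -/

/-- The tensor product of two modules over a Hopf algebra `H`, with the action
`h • (x ⊗ y) = ∑ h₍₁₎ • x ⊗ h₍₂₎ • y`. -/
def TensMod (k : Type u) (H : Type v) (X : Type w) (Y : Type w) [Field k] [Ring H] [HopfAlgebra k H]
    [AddCommGroup X] [Module k X] [AddCommGroup Y] [Module k Y] : Type w :=
  X ⊗[k] Y

namespace TensMod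

section VectorSpace

variable (k : Type u) (H : Type v) (X Y : Type w) [Field k] [Ring H] [HopfAlgebra k H]
  [AddCommGroup X] [Module k X] [AddCommGroup Y] [Module k Y]

instance : AddCommGroup (TensMod k H X Y) := inferInstanceAs (AddCommGroup (X ⊗[k] Y))

instance : Module k (TensMod k H X Y) := inferInstanceAs (Module k (X ⊗[k] Y))

instance [Module.Finite k X] [Module.Finite k Y] : Module.Finite k (TensMod k H X Y) :=
  inferInstanceAs (Module.Finite k (X ⊗[k] Y))

lemma finrank_eq : Module.finrank k (TensMod k H X Y) = Module.finrank k X * Module.finrank k Y :=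
  Module.finrank_tensorProduct

/-- The identification of the `H`-module `X ⊗ Y` with the tensor product of vector spaces. -/
def equiv : (X ⊗[k] Y) ≃ₗ[k] TensMod k H X Y := LinearEquiv.refl k _

variable {X Y}

/-- Pure tensors in the `H`-module `X ⊗ Y`. -/
def tmul (x : X) (y : Y) : TensMod k H X Y := equiv k H X Y (x ⊗ₜ y)

variable {k H}

lemma add_tmul (x x' : X) (y : Y) : tmul k H (x + x') y = tmul k H x y + tmul k H x' y :=
  TensorProduct.add_tmul x x' y

lemma tmul_add (x : X) (y y' : Y) : tmul k H x (y + y') = tmul k H x y + tmul k H x y' :=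
  TensorProduct.tmul_add x y y'

lemma smul_tmul_left (c : k) (x : X) (y : Y) : tmul k H (c • x) y = c • tmul k H x y := rfl

lemma smul_tmul_right (c : k) (x : X) (y : Y) : tmul k H x (c • y) = c • tmul k H x y :=
  TensorProduct.tmul_smul c x y

lemma sum_tmul {ι : Type*} (s : Finset ι) (f : ι → X) (y : Y) :
    tmul k H (∑ i ∈ s, f i) y = ∑ i ∈ s, tmul k H (f i) y :=
  TensorProduct.sum_tmul s f y

lemma tmul_sum {ι : Type*} (s : Finset ι) (x : X) (f : ι → Y) :
    tmul k H x (∑ i ∈ s, f i) = ∑ i ∈ s, tmul k H x (f i) :=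
  TensorProduct.tmul_sum x s f

lemma isLinearMap_left (f : H →ₗ[k] X) (y : Y) :
    IsLinearMap k fun a => tmul k H (f a) y :=
  ⟨fun a b => by rw [map_add, add_tmul], fun c a => by
    rw [map_smul, smul_tmul_left]⟩

lemma isLinearMap_right (f : H →ₗ[k] Y) (x : X) :
    IsLinearMap k fun a => tmul k H x (f a) :=
  ⟨fun a b => by rw [map_add, tmul_add], fun c a => by
    rw [map_smul, smul_tmul_right]⟩

@[elab_as_elim]
lemma induction {p : TensMod k H X Y → Prop} (zero : p 0) (tmul : ∀ x y, p (tmul k H x y))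
    (add : ∀ x y, p x → p y → p (x + y)) (z : TensMod k H X Y) : p z :=
  TensorProduct.induction_on (motive := fun z => p z) z zero tmul add

end VectorSpace

variable (k : Type u) (H : Type v) (X Y : Type w) [Field k] [Ring H] [HopfAlgebra k H]
  [AddCommGroup X] [Module k X] [Module H X] [IsScalarTower k H X]
  [AddCommGroup Y] [Module k Y] [Module H Y] [IsScalarTower k H Y]

/-- The action of `H` on `X ⊗ Y` as an algebra homomorphism. -/
noncomputable def act : H →ₐ[k] Module.End k (X ⊗[k] Y) :=
  (Module.endTensorEndAlgHom (R := k) (S := k) (A := k)).comp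
    ((Algebra.TensorProduct.map (Algebra.lsmul k k X) (Algebra.lsmul k k Y)).comp
      (Bialgebra.comulAlgHom k H))

noncomputable instance : Module H (TensMod k H X Y) :=
  Module.compHom (X ⊗[k] Y) (act k H X Y).toRingHom

instance : IsScalarTower k H (TensMod k H X Y) where
  smul_assoc c h x := LinearMap.congr_fun (map_smul (act k H X Y) c h) x

variable {k H X Y}

lemma smul_tmul {ι : Type*} {h : H} (r : Coalgebra.Repr k h ι) (x : X) (y : Y) :
    h • tmul k H x y = ∑ i ∈ r.index, tmul k H (r.left i • x) (r.right i • y) := by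
  change act k H X Y h (x ⊗ₜ y) = ∑ i ∈ r.index, (r.left i • x) ⊗ₜ (r.right i • y)
  simp only [act, AlgHom.comp_apply, Bialgebra.comulAlgHom_apply]
  rw [← r.eq]
  simp [map_sum, LinearMap.sum_apply, Module.endTensorEndAlgHom_apply]

end TensMod

namespace HomMod

variable (k : Type u) (H : Type v) (M N : Type w) [Field k] [Ring H] [HopfAlgebra k H]
  [AddCommGroup M] [Module k M] [Module H M] [IsScalarTower k H M]
  [AddCommGroup N] [Module k N] [Module H N] [IsScalarTower k H N]

instance : Module k (HomMod k H M N) := inferInstanceAs (Module k (M →ₗ[k] N))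

instance : IsScalarTower k H (HomMod k H M N) where
  smul_assoc c h x :=
     LinearMap.congr_fun (map_smul (act k H M N) c h) x

/-- `HomMod.of` as a linear equivalence. -/
def lof : (M →ₗ[k] N) ≃ₗ[k] HomMod k H M N := LinearEquiv.refl k _

instance [Module.Finite k M] [Module.Finite k N] : Module.Finite k (HomMod k H M N) :=
  inferInstanceAs (Module.Finite k (M →ₗ[k] N))

lemma lof_symm_smul {ι : Type*} {h : H} (r : Coalgebra.Repr k h ι) (f : HomMod k H M N) (m : M) :
    (lof k H M N).symm (h • f) m =
      ∑ i ∈ r.index, r.left i • (lof k H M N).symm f (HopfAlgebra.antipode k (r.right i) • m) :=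
  smul_apply k H M N h r f m

end HomMod

/-- A `k`-linear equivalence that commutes with the action of `H`, as an `H`-linear one. -/
def equivOfSMul {k H X Y : Type*} [Field k] [Ring H] [AddCommGroup X] [Module k X] [Module H X]
    [AddCommGroup Y] [Module k Y] [Module H Y] (e : X ≃ₗ[k] Y)
    (he : ∀ (h : H) (x : X), e (h • x) = h • e x) : X ≃ₗ[H] Y :=
  { e.toAddEquiv with map_smul' := he }

/-! ### Natural isomorphisms between tensor products and Hom spaces. -/

section Equivalences

variable {k : Type u} {H : Type v} {M X Y : Type w} [Field k] [Ring H] [HopfAlgebra k H]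
  [AddCommGroup M] [Module k M] [Module H M] [IsScalarTower k H M]
  [AddCommGroup X] [Module k X] [Module H X] [IsScalarTower k H X]
  [AddCommGroup Y] [Module k Y] [Module H Y] [IsScalarTower k H Y]

/-- The orbit map `h ↦ h • x`. -/
def orbitMap (k : Type u) (H : Type v) {X : Type w} [Field k] [Ring H] [Algebra k H]
    [AddCommGroup X] [Module k X] [Module H X] [IsScalarTower k H X] (x : X) : H →ₗ[k] X :=
  (LinearMap.toSpanSingleton H X x).restrictScalars k

@[simp]
lemma orbitMap_apply (x : X) (h : H) : orbitMap k H x h = h • x := rfl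

/-- The tensor product of `H`-modules over a cocommutative Hopf algebra is symmetric. -/
noncomputable def tensComm [IsCocomm k H] : TensMod k H X Y ≃ₗ[H] TensMod k H Y X :=
  equivOfSMul
    ((TensMod.equiv k H X Y).symm ≪≫ₗ TensorProduct.comm k X Y ≪≫ₗ TensMod.equiv k H Y X)
    (by
      intro h z
      induction z using TensMod.induction with
      | zero => simp
      | add x y hx hy => rw [smul_add, map_add, map_add, smul_add, hx, hy]
      | tmul x y =>
        rw [TensMod.smul_tmul (ℛ k h), map_sum]
        exact (TensMod.smul_tmul (reprSwap (ℛ k h)) y x).symm)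

/-- `Hom_k(M, -)` preserves isomorphisms of `H`-modules. -/
def homCongr (e : X ≃ₗ[H] Y) : HomMod k H M X ≃ₗ[H] HomMod k H M Y :=
  equivOfSMul
    ((HomMod.lof k H M X).symm ≪≫ₗ (LinearEquiv.congrRight (e.restrictScalars k)) ≪≫ₗ
      HomMod.lof k H M Y)
    (by
      intro h f
      refine (HomMod.lof k H M Y).symm.injective (LinearMap.ext fun m => ?_)
      rw [HomMod.lof_symm_smul _ _ _ _ (ℛ k h)]
      have h1 : ∀ g : HomMod k H M X, (HomMod.lof k H M Y).symm
          (((HomMod.lof k H M X).symm ≪≫ₗ (LinearEquiv.congrRight (e.restrictScalars k)) ≪≫ₗ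
            HomMod.lof k H M Y) g) m = e ((HomMod.lof k H M X).symm g m) := fun _ => rfl
      rw [h1, HomMod.lof_symm_smul _ _ _ _ (ℛ k h), map_sum]
      exact Finset.sum_congr rfl fun i _ => map_smul e _ _)

/-- `Hom_k(M, X) ⊗ Y` is isomorphic to `Hom_k(M, X ⊗ Y)`. -/
noncomputable def homTens [IsCocomm k H] [Module.Finite k M] :
    TensMod k H (HomMod k H M X) Y ≃ₗ[H] HomMod k H M (TensMod k H X Y) :=
  equivOfSMul
    ((TensMod.equiv k H (HomMod k H M X) Y).symm ≪≫ₗ rTensorHomEquivHomRTensor k M X Y ≪≫ₗ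
      HomMod.lof k H M (TensMod k H X Y))
    (by
      intro h z
      set Θ := ((TensMod.equiv k H (HomMod k H M X) Y).symm ≪≫ₗ
        rTensorHomEquivHomRTensor k M X Y ≪≫ₗ HomMod.lof k H M (TensMod k H X Y)) with hΘ
      have hΘt : ∀ (f : HomMod k H M X) (y : Y) (m : M),
          (HomMod.lof k H M (TensMod k H X Y)).symm (Θ (TensMod.tmul k H f y)) m =
            TensMod.tmul k H ((HomMod.lof k H M X).symm f m) y := by
        intro f y m
        have := LinearMap.congr_fun (rTensorHomEquivHomRTensor_toLinearMap k M X Y)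
          ((HomMod.lof k H M X).symm f ⊗ₜ y)
        have := LinearMap.congr_fun this m
        rw [rTensorHomToHomRTensor_apply] at this
        exact this
      induction z using TensMod.induction with
      | zero => simp
      | add x y hx hy => rw [smul_add, map_add, map_add, smul_add, hx, hy]
      | tmul f y =>
        refine (HomMod.lof k H M _).symm.injective (LinearMap.ext fun m => ?_)
        set f' := (HomMod.lof k H M X).symm f with hf'
        let S := HopfAlgebra.antipode k (A := H)
        let T : H → H → H → TensMod k H X Y := fun a b c =>
          TensMod.tmul k H (a • f' (S b • m)) (c • y)
        have h₁ : ∀ b c, IsLinearMap k (T · b c) := fun b c =>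
          TensMod.isLinearMap_left (orbitMap k H (f' (S b • m))) (c • y)
        have h₂ : ∀ a c, IsLinearMap k (T a · c) := fun a c =>
          TensMod.isLinearMap_left (orbitMap k H m |>.comp S |> f'.comp |>
            (Algebra.lsmul k k X a).comp) (c • y)
        have h₃ : ∀ a b, IsLinearMap k (T a b ·) := fun a b =>
          TensMod.isLinearMap_right (orbitMap k H y) _
        let r := ℛ k h
        have e1 := sum_repr_assoc r (fun i => ℛ k _) (fun i => ℛ k _) T h₁ h₂ h₃
        -- The two actions differ only by exchanging h₂ and h₃ in the threefold coproduct;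
        -- `reprSwap` supplies this exchange.
        have e2 := sum_repr_assoc r (fun i => ℛ k _) (fun i => reprSwap (ℛ k _))
          (fun a b c => T a c b) (fun b c => h₁ c b) (fun a c => h₃ a c) (fun a b => h₂ a b)
        simp only [reprSwap_left, reprSwap_right, reprSwap_index] at e2
        have e3 : (HomMod.lof k H M (TensMod k H X Y)).symm (Θ (h • TensMod.tmul k H f y)) m =
            ∑ i ∈ r.index, ∑ j ∈ (ℛ k (r.left i)).index,
              T ((ℛ k (r.left i)).left j) ((ℛ k (r.left i)).right j) (r.right i) := by
          rw [TensMod.smul_tmul r, map_sum, map_sum, LinearMap.sum_apply]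
          refine Finset.sum_congr rfl fun i _ => ?_
          rw [hΘt, HomMod.lof_symm_smul _ _ _ _ (ℛ k (r.left i))]
          rw [TensMod.sum_tmul]
        have e4 : (HomMod.lof k H M (TensMod k H X Y)).symm (h • Θ (TensMod.tmul k H f y)) m =
            ∑ i ∈ r.index, ∑ j ∈ (ℛ k (r.left i)).index,
              T ((ℛ k (r.left i)).left j) (r.right i) ((ℛ k (r.left i)).right j) := by
          rw [HomMod.lof_symm_smul _ _ _ _ r]
          refine Finset.sum_congr rfl fun i _ => ?_
          rw [hΘt, TensMod.smul_tmul (ℛ k (r.left i))]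
        rw [e3, e4, e1, e2])

/-- `Hom_k(M, X) ⊗ Y` is isomorphic to `Hom_k(M, Y) ⊗ X`. -/
noncomputable def homTensSwap [IsCocomm k H] [Module.Finite k M] :
    TensMod k H (HomMod k H M X) Y ≃ₗ[H] TensMod k H (HomMod k H M Y) X :=
  homTens ≪≫ₗ homCongr tensComm ≪≫ₗ homTens.symm

end Equivalences

/-! ### Tensoring M with a module of the form trivial plus free. -/

section Generation

variable {k : Type u} {H : Type v} {W M : Type w} [Field k] [Ring H] [HopfAlgebra k H]
  [AddCommGroup M] [Module k M] [Module H M] [IsScalarTower k H M]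
  [AddCommGroup W] [Module k W] [Module H W] [IsScalarTower k H W]

/-- Expanding the right side gives ∑ y₁ • x ⊗ (y₂ S(y₃)) • m, where y₂ S(y₃) collapses to the
counit. It shows that the submodule generated by x ⊗ M contains H x ⊗ M. -/
lemma tmul_smul_left_eq (y : H) (x : W) (m : M) {ι : Type*} (r : Coalgebra.Repr k y ι) :
    TensMod.tmul k H (y • x) m = ∑ i ∈ r.index,
      r.left i • TensMod.tmul k H x (HopfAlgebra.antipode k (r.right i) • m) := by
  let S := HopfAlgebra.antipode k (A := H)
  let T : H → H → H → TensMod k H W M := fun a b c =>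
    TensMod.tmul k H (a • x) ((b * S c) • m)
  have key := sum_repr_assoc r (fun i => ℛ k _) (fun i => ℛ k _) T
    (fun b c => TensMod.isLinearMap_left (orbitMap k H x) _)
    (fun a c => TensMod.isLinearMap_right ((orbitMap k H m).comp (LinearMap.mulRight k (S c))) _)
    (fun a b => TensMod.isLinearMap_right
      ((orbitMap k H m).comp ((LinearMap.mulLeft k b).comp S)) _)
  have e1 : ∀ i, ∑ j ∈ (ℛ k (r.left i)).index,
      T ((ℛ k (r.left i)).left j) ((ℛ k (r.left i)).right j) (r.right i) =
      r.left i • TensMod.tmul k H x (HopfAlgebra.antipode k (r.right i) • m) := by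
    intro i
    rw [TensMod.smul_tmul (ℛ k (r.left i))]
    exact Finset.sum_congr rfl fun j _ => by simp only [T, mul_smul, S]
  have e2 : ∀ i, ∑ j ∈ (ℛ k (r.right i)).index,
      T (r.left i) ((ℛ k (r.right i)).left j) ((ℛ k (r.right i)).right j) =
      TensMod.tmul k H ((counit (R := k) (r.right i) • r.left i) • x) m := by
    intro i
    rw [← TensMod.tmul_sum, ← Finset.sum_smul]
    simp only [S]
    rw [HopfAlgebra.sum_mul_antipode_eq_smul (R := k) (ℛ k (r.right i)), smul_assoc, one_smul,
      smul_assoc, TensMod.smul_tmul_left, TensMod.smul_tmul_right]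
  rw [Finset.sum_congr rfl fun i _ => (e1 i).symm, key, Finset.sum_congr rfl fun i _ => e2 i]
  rw [← TensMod.sum_tmul, ← Finset.sum_smul]
  congr 2
  exact (sum_counit_right_smul r).symm

/-- If `W` is spanned by a fixed vector together with `r` free generators, as the dimension shows,
then `W ⊗ M` is the direct sum of `M` and a free module. -/
lemma tensMod_equiv_prod_free [Module.Finite k H] [Module.Finite k M] [Module.Finite k W]
    {r n : ℕ} (w₀ : W) (hw₀ : ∀ h : H, h • w₀ = counit (R := k) h • w₀) (g : Fin r → W)
    (hg : ∀ x : W, ∃ (c : k) (y : Fin r → H), x = c • w₀ + ∑ i, y i • g i)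
    (hW : Module.finrank k W = r * Module.finrank k H + 1) (hM : Module.finrank k M = n) :
    Nonempty (TensMod k H W M ≃ₗ[H] M × (Fin r × Fin n → H)) := by
  let b := Module.finBasisOfFinrankEq k M hM
  let F₀ : M →ₗ[H] TensMod k H W M :=
    { toFun := fun m => TensMod.tmul k H w₀ m
      map_add' := TensMod.tmul_add w₀
      map_smul' := by
        intro h m
        rw [RingHom.id_apply, TensMod.smul_tmul (ℛ k h)]
        simp only [hw₀, TensMod.smul_tmul_left, ← TensMod.smul_tmul_right]
        rw [← TensMod.tmul_sum]
        congr 1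
        conv_lhs => rw [← Coalgebra.sum_counit_smul (ℛ k h), Finset.sum_smul]
        simp only [smul_assoc] }
  let F : M × (Fin r × Fin n → H) →ₗ[H] TensMod k H W M :=
    F₀.coprod (Fintype.linearCombination H fun ij => TensMod.tmul k H (g ij.1) (b ij.2))
  have hF0 : ∀ m, TensMod.tmul k H w₀ m ∈ LinearMap.range F := fun m => ⟨(m, 0), by simp [F, F₀]⟩
  have hFb : ∀ i j, TensMod.tmul k H (g i) (b j) ∈ LinearMap.range F := fun i j =>
    ⟨(0, Pi.single (i, j) 1), by simp [F]⟩
  have hsc : ∀ (c : k) (x : TensMod k H W M), x ∈ LinearMap.range F →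
      c • x ∈ LinearMap.range F := by
    intro c x hx
    rw [← one_smul H x, ← smul_assoc]
    exact Submodule.smul_mem _ _ hx
  have hFg : ∀ i m, TensMod.tmul k H (g i) m ∈ LinearMap.range F := by
    intro i m
    rw [← b.sum_repr m]
    rw [TensMod.tmul_sum]
    refine Submodule.sum_mem _ fun j _ => ?_
    rw [TensMod.smul_tmul_right]
    exact hsc _ _ (hFb i j)
  have hsurj : Function.Surjective F := by
    rw [← LinearMap.range_eq_top, eq_top_iff]
    rintro z -
    induction z using TensMod.induction with
    | zero => exact zero_mem _
    | add x y hx hy => exact add_mem hx hy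
    | tmul x m =>
      obtain ⟨c, y, rfl⟩ := hg x
      rw [TensMod.add_tmul, TensMod.smul_tmul_left, TensMod.sum_tmul]
      refine add_mem (hsc _ _ (hF0 m)) (Submodule.sum_mem _ fun i _ => ?_)
      rw [tmul_smul_left_eq (y i) (g i) m (ℛ k (y i))]
      exact Submodule.sum_mem _ fun j _ => Submodule.smul_mem _ _ (hFg i _)
  -- Both sides have dimension n (r dim H + 1), so the surjection `F` is bijective; the dimension
  -- count takes the place of freeness of the `g i`.
  have hdim : Module.finrank k (M × (Fin r × Fin n → H)) =
      Module.finrank k (TensMod k H W M) := by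
    rw [TensMod.finrank_eq, hW, hM, Module.finrank_prod, Module.finrank_pi_fintype]
    simp only [Finset.sum_const, Finset.card_univ, Fintype.card_prod, Fintype.card_fin, hM,
      smul_eq_mul]
    ring
  have hinj : Function.Injective F :=
    (LinearMap.injective_iff_surjective_of_finrank_eq_finrank (f := F.restrictScalars k) hdim).2
      hsurj
  exact ⟨(LinearEquiv.ofBijective F ⟨hinj, hsurj⟩).symm⟩

end Generation

/-- Every nonzero finite-dimensional module over the Hopf algebra `H` has a nonzero vector on which
`H` acts through the counit. -/
def HasFixedVectors (k H : Type u) [Field k] [Ring H] [HopfAlgebra k H] : Prop :=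
  ∀ (V : Type u) [AddCommGroup V] [Module k V] [Module H V] [IsScalarTower k H V]
    [Module.Finite k V] [Nontrivial V],
    ∃ v : V, v ≠ 0 ∧ ∀ h : H, h • v = counit (R := k) h • v

/-! ### Locality and cancellation of free summands. -/

section Local

variable {k H : Type u} [Field k] [Ring H] [HopfAlgebra k H]

/-- Every nonzero submodule of a finite-dimensional module contains a nonzero fixed vector. -/
lemma HasFixedVectors.exists_mem (hH : HasFixedVectors k H) {V : Type u} [AddCommGroup V]
    [Module k V] [Module H V] [IsScalarTower k H V] [Module.Finite k V] {K : Submodule H V}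
    (hK : K ≠ ⊥) : ∃ v ∈ K, v ≠ 0 ∧ ∀ h : H, h • v = counit (R := k) h • v := by
  have : Nontrivial K := Submodule.nontrivial_iff_ne_bot.2 hK
  have : Module.Finite k K := inferInstanceAs (Module.Finite k (K.restrictScalars k))
  obtain ⟨v, hv, hfix⟩ := hH K
  exact ⟨v, v.2, by simpa using hv, fun h => by simpa using congrArg Subtype.val (hfix h)⟩

variable [Module.Finite k H]

/-- A Hopf algebra with fixed vectors is local: proper left ideals lie in the augmentation ideal. -/
lemma HasFixedVectors.eq_top_of_counit_ne_zero (hH : HasFixedVectors k H) (J : Submodule H H)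
    {x : H} (hx : x ∈ J) (hε : counit (R := k) x ≠ 0) : J = ⊤ := by
  by_contra hJ
  obtain ⟨m, hm, hJm⟩ := Ideal.exists_le_maximal (J : Ideal H) hJ
  have : Nontrivial (H ⧸ m) := Submodule.Quotient.nontrivial_iff.2 hm.ne_top
  obtain ⟨v, hv, hfix⟩ := hH (H ⧸ m)
  obtain ⟨w, rfl⟩ := Submodule.Quotient.mk_surjective _ v
  have hw : w ∉ m := fun h => hv ((Submodule.Quotient.mk_eq_zero _).2 h)
  have hfix' : ∀ g : H, counit (R := k) g = 0 → g * w ∈ m := by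
    intro g hg
    have := hfix g
    rw [hg, zero_smul, ← Submodule.Quotient.mk_smul, Submodule.Quotient.mk_eq_zero] at this
    exact this
  have htop : m ⊔ Ideal.span {w} = ⊤ :=
    hm.1.2 _ (lt_of_le_of_ne le_sup_left fun h => hw (by
      rw [h]; exact Ideal.mem_sup_right (Ideal.mem_span_singleton_self w)))
  obtain ⟨a, ha, b, hb, hab⟩ := Submodule.mem_sup.1 (htop ▸ Submodule.mem_top : (1 : H) ∈ _)
  obtain ⟨c, rfl⟩ := Submodule.mem_span_singleton.1 hb
  -- The augmentation ideal kills the generator `w` of H/m. Hence it lies in m, and with x also the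
  -- nonzero scalar ε(x) would lie in m.
  set z : H := x - algebraMap k H (counit (R := k) x) with hz
  have hz0 : counit (R := k) z = 0 := by
    simp [hz, Bialgebra.counit_algebraMap]
  have hzm : z ∈ m := by
    rw [← mul_one z, ← hab, mul_add, smul_eq_mul, ← mul_assoc]
    exact add_mem (m.mul_mem_left _ ha) (hfix' _ (by simp [Bialgebra.counit_mul, hz0]))
  have h1 : algebraMap k H (counit (R := k) x) ∈ m := by
    have := sub_mem (hJm hx) hzm
    simpa [hz] using this
  refine hm.ne_top (m.eq_top_iff_one.2 ?_)
  have := m.mul_mem_left (algebraMap k H (counit (R := k) x)⁻¹) h1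
  rwa [← map_mul, inv_mul_cancel₀ hε, map_one] at this

/-- Cancellation of a free summand of rank one. -/
lemma HasFixedVectors.cancel_one (hH : HasFixedVectors k H) {B C : Type*} [AddCommGroup B]
    [Module H B] [AddCommGroup C] [Module H C] (e : (H × B) ≃ₗ[H] (H × C)) :
    Nonempty (B ≃ₗ[H] C) := by
  let β : B →ₗ[H] H := LinearMap.fst H H C ∘ₗ e.toLinearMap ∘ₗ LinearMap.inr H H B
  let a : H := (e (1, 0)).1
  have hf : ∀ h b, (e (h, b)).1 = h * a + β b := by
    intro h b
    have : ((h, b) : H × B) = h • (1, 0) + (0, b) := by simp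
    rw [this, map_add, map_smul]
    rfl
  have hker : ∀ x, (e x).1 = 0 → e.symm (0, (e x).2) = x := by
    intro x hx
    rw [LinearEquiv.symm_apply_eq]
    exact Prod.ext hx.symm rfl
  have hC : ∀ c, (e.symm (0, c)).1 * a + β (e.symm (0, c)).2 = 0 := by
    intro c
    rw [← hf]
    simp
  have hC0 : ∀ c, (e.symm (0, c)).1 = 0 → (e.symm (0, c)).2 = 0 → c = 0 := by
    intro c h1 h2
    have h3 : e.symm (0, c) = 0 := Prod.ext h1 h2
    simpa using congrArg Prod.snd ((LinearEquiv.symm_apply_eq e).1 h3)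
  let s : C →ₗ[H] H × B := e.symm.toLinearMap ∘ₗ LinearMap.inr H H C
  by_cases ha : counit (R := k) a = 0
  · have htop : LinearMap.range β = ⊤ := by
      refine hH.eq_top_of_counit_ne_zero _ (x := β (e.symm (1, 0)).2) ⟨_, rfl⟩ ?_
      have h1 : (e.symm (1, 0)).1 * a + β (e.symm (1, 0)).2 = 1 := by
        rw [← hf]
        simp
      have h2 := congrArg (counit (R := k)) h1
      rw [map_add, Bialgebra.counit_mul, ha, mul_zero, zero_add, Bialgebra.counit_one] at h2
      rw [h2]
      exact one_ne_zero
    obtain ⟨s₁, hs₁⟩ := LinearMap.range_eq_top.1 htop 1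
    -- `s` identifies C with the kernel of (h, b) ↦ h a + β b. This functional takes the value a -
    -- (1 + a) = -1 on (1, -(1 + a) s₁), so that vector spans a free complement of the kernel. `F`
    -- is the restriction to the kernel of the map H × B → B that kills this complement and is the
    -- identity on B.
    let F : C →ₗ[H] B := LinearMap.snd H H B ∘ₗ s +
      (LinearMap.toSpanSingleton H B ((1 + a) • s₁)) ∘ₗ LinearMap.fst H H B ∘ₗ s
    have hF : ∀ c, F c = (e.symm (0, c)).2 + (e.symm (0, c)).1 • (1 + a) • s₁ := fun c => rfl
    refine ⟨(LinearEquiv.ofBijective F ⟨?_, ?_⟩).symm⟩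
    · rw [injective_iff_map_eq_zero]
      intro c hc
      have h1 : (e.symm (0, c)).1 = 0 := by
        have := congrArg β hc
        rw [hF, map_add, map_smul, map_smul, hs₁, map_zero, smul_eq_mul, smul_eq_mul, mul_one,
          mul_add, mul_one] at this
        have h2 := hC c
        rw [add_comm] at h2
        rw [eq_neg_of_add_eq_zero_left h2] at this
        simpa using this
      refine hC0 c h1 ?_
      rw [hF, h1] at hc
      simpa using hc
    · intro b
      have h0 : (e (β b, b - β b • (1 + a) • s₁)).1 = 0 := by
        rw [hf, map_sub, map_smul, map_smul, hs₁]
        simp [mul_add]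
      refine ⟨(e (β b, b - β b • (1 + a) • s₁)).2, ?_⟩
      rw [hF, hker _ h0]
      simp
  -- Here right multiplication by a is bijective, so (1, 0) already spans a complement of the kernel
  -- and the projection to B suffices.
  · have htop : LinearMap.range (LinearMap.toSpanSingleton H H a) = ⊤ :=
      hH.eq_top_of_counit_ne_zero _ (x := a) ⟨1, by simp⟩ ha
    have hsurj := LinearMap.range_eq_top.1 htop
    have hinj : Function.Injective (LinearMap.toSpanSingleton H H a) :=
      (LinearMap.injective_iff_surjective
        (f := (LinearMap.toSpanSingleton H H a).restrictScalars k)).2 hsurj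
    obtain ⟨a', ha'⟩ := hsurj 1
    simp only [LinearMap.toSpanSingleton_apply, smul_eq_mul] at ha'
    let F : C →ₗ[H] B := LinearMap.snd H H B ∘ₗ s
    have hF : ∀ c, F c = (e.symm (0, c)).2 := fun c => rfl
    refine ⟨(LinearEquiv.ofBijective F ⟨?_, ?_⟩).symm⟩
    · rw [injective_iff_map_eq_zero]
      intro c hc
      rw [hF] at hc
      refine hC0 c ?_ hc
      have h2 := hC c
      rw [hc, map_zero, add_zero] at h2
      exact (injective_iff_map_eq_zero _).1 hinj _ h2
    · intro b
      have h0 : (e (-(β b) * a', b)).1 = 0 := by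
        rw [hf, mul_assoc, ha']
        simp
      refine ⟨(e (-(β b) * a', b)).2, ?_⟩
      rw [hF, hker _ h0]

/-- Moving the first coordinate of a free module to the front of a product. -/
def prodFinSuccEquiv (R D : Type*) [Ring R] [AddCommGroup D] [Module R D] (m : ℕ) :
    (D × (Fin (m + 1) → R)) ≃ₗ[R] (R × (D × (Fin m → R))) :=
  (LinearEquiv.refl R D).prodCongr (Fin.consLinearEquiv R fun _ => R).symm ≪≫ₗ
    LinearEquiv.prodComm R _ _ ≪≫ₗ LinearEquiv.prodAssoc R _ _ _ ≪≫ₗ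
    (LinearEquiv.refl R R).prodCongr (LinearEquiv.prodComm R _ _)

/-- Cancellation of free summands of finite rank. -/
lemma HasFixedVectors.cancel (hH : HasFixedVectors k H) {ι : Type*} [Finite ι] {B C : Type*}
    [AddCommGroup B] [Module H B] [AddCommGroup C] [Module H C]
    (e : (B × (ι → H)) ≃ₗ[H] (C × (ι → H))) : Nonempty (B ≃ₗ[H] C) := by
  have key : ∀ (m : ℕ) (_ : (B × (Fin m → H)) ≃ₗ[H] (C × (Fin m → H))), Nonempty (B ≃ₗ[H] C) := by
    intro m
    induction m with
    | zero => exact fun e => ⟨LinearEquiv.prodUnique.symm ≪≫ₗ e ≪≫ₗ LinearEquiv.prodUnique⟩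
    | succ m ih =>
      intro e
      obtain ⟨e'⟩ := hH.cancel_one ((prodFinSuccEquiv H B m).symm ≪≫ₗ e ≪≫ₗ prodFinSuccEquiv H C m)
      exact ih e'
  obtain ⟨m, ⟨σ⟩⟩ := Finite.exists_equiv_fin ι
  exact key m (((LinearEquiv.refl H B).prodCongr (LinearEquiv.funCongrLeft H H σ)) ≪≫ₗ
    e ≪≫ₗ ((LinearEquiv.refl H C).prodCongr (LinearEquiv.funCongrLeft H H σ.symm)))

end Local

/-! ## Integrals and self-injectivity -/

section Frobenius

variable {k H : Type u} [Field k] [Ring H] [HopfAlgebra k H]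

/-- Contraction of the first factor of the coproduct of `x` with a functional. -/
noncomputable def contract (x : H) : Module.Dual k H →ₗ[k] H where
  toFun φ := TensorProduct.lid k H (φ.rTensor H (comul (R := k) x))
  map_add' φ ψ := by simp [LinearMap.rTensor_add]
  map_smul' c φ := by simp [LinearMap.rTensor_smul]

lemma contract_apply {ι : Type*} {x : H} (r : Coalgebra.Repr k x ι) (φ : Module.Dual k H) :
    contract x φ = ∑ i ∈ r.index, φ (r.left i) • r.right i := by
  change TensorProduct.lid k H (φ.rTensor H (comul (R := k) x)) = _
  rw [← r.eq]
  simp [map_sum]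

/-- Left multiplication of a contraction of a left integral. -/
lemma mul_contract {L : H} (hL : ∀ h : H, h * L = counit (R := k) h • L) (h : H)
    (φ : Module.Dual k H) :
    h * contract L φ = contract L (φ ∘ₗ LinearMap.mulLeft k (HopfAlgebra.antipode k h)) := by
  let S := HopfAlgebra.antipode k (A := H)
  let r := ℛ k h
  let ρ := ℛ k L
  -- The sum of φ(S(h₁) h₂ L₁) h₃ L₂ is computed twice: either S(h₁) h₂ collapses to the counit, or
  -- h₂ L₁ ⊗ h₃ L₂ is the coproduct of h₂ L, a scalar multiple of that of the integral L.
  have key := sum_repr_assoc r (fun i => ℛ k _) (fun i => ℛ k _)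
    (fun a b c => ∑ s ∈ ρ.index, φ (S a * b * ρ.left s) • (c * ρ.right s))
    (fun b c => ⟨fun x y => by simp [add_mul, add_smul, Finset.sum_add_distrib],
      fun t x => by simp [Finset.smul_sum, mul_smul]⟩)
    (fun b c => ⟨fun x y => by simp [add_mul, mul_add, add_smul, Finset.sum_add_distrib],
      fun t x => by simp [Finset.smul_sum, mul_smul]⟩)
    (fun b c => ⟨fun x y => by simp [add_mul, Finset.sum_add_distrib],
      fun t x => by simp [Finset.smul_sum, smul_comm t]⟩)
  have e1 : ∀ i, ∑ j ∈ (ℛ k (r.left i)).index, ∑ s ∈ ρ.index,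
      φ (S ((ℛ k (r.left i)).left j) * (ℛ k (r.left i)).right j * ρ.left s) •
        (r.right i * ρ.right s) = (counit (R := k) (r.left i) • r.right i) * contract L φ := by
    intro i
    rw [Finset.sum_comm, contract_apply ρ, Finset.mul_sum]
    refine Finset.sum_congr rfl fun s _ => ?_
    rw [← Finset.sum_smul, ← map_sum, ← Finset.sum_mul]
    simp only [S]
    rw [HopfAlgebra.sum_antipode_mul_eq_smul (R := k)]
    rw [smul_mul_assoc, one_mul, map_smul, smul_eq_mul, mul_smul, smul_mul_assoc, mul_smul_comm]
  have e2 : ∀ i, ∑ j ∈ (ℛ k (r.right i)).index, ∑ s ∈ ρ.index,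
      φ (S (r.left i) * (ℛ k (r.right i)).left j * ρ.left s) •
        ((ℛ k (r.right i)).right j * ρ.right s) =
      contract L (φ ∘ₗ LinearMap.mulLeft k (S (counit (R := k) (r.right i) • r.left i))) := by
    intro i
    have h1 := (congrArg (contract · (φ ∘ₗ LinearMap.mulLeft k (S (r.left i))))
      (hL (r.right i))).symm.trans (contract_apply ((ℛ k (r.right i)).mul ρ) _)
    have h2 : ∀ ψ : Module.Dual k H, contract (counit (R := k) (r.right i) • L) ψ =
        counit (R := k) (r.right i) • contract L ψ := fun ψ => by
      simp [contract]
    rw [h2] at h1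
    have h3 : φ ∘ₗ LinearMap.mulLeft k (S (counit (R := k) (r.right i) • r.left i)) =
        counit (R := k) (r.right i) • (φ ∘ₗ LinearMap.mulLeft k (S (r.left i))) := by
      ext y; simp
    rw [h3, map_smul, h1, ← Finset.sum_product']
    exact Finset.sum_congr rfl fun p _ => by simp [mul_assoc]
  simp only [e1, e2] at key
  rw [← Finset.sum_mul, Coalgebra.sum_counit_smul r] at key
  refine key.trans ?_
  rw [← map_sum]
  congr 1
  ext y
  simp only [LinearMap.sum_apply, LinearMap.comp_apply, LinearMap.mulLeft_apply]
  rw [← map_sum, ← Finset.sum_mul, ← map_sum, sum_counit_right_smul r]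

lemma counit_contract (x : H) (φ : Module.Dual k H) : counit (R := k) (contract x φ) = φ x := by
  rw [contract_apply (ℛ k x), map_sum]
  conv_rhs => rw [← sum_counit_right_smul (ℛ k x), map_sum]
  exact Finset.sum_congr rfl fun i _ => by simp [mul_comm]

variable [Module.Finite k H]

/-- The range is a left ideal by `mul_contract` and contains an element of nonzero counit by
`counit_contract`, so locality makes it all of H. -/
lemma HasFixedVectors.contract_bijective (hH : HasFixedVectors k H) {L : H} (hL0 : L ≠ 0)
    (hL : ∀ h : H, h * L = counit (R := k) h • L) :
    Function.Bijective (contract (k := k) L) := by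
  have hsurj : Function.Surjective (contract (k := k) L) := by
    let J : Submodule H H :=
      { carrier := Set.range (contract (k := k) L)
        add_mem' := by
          rintro _ _ ⟨φ, rfl⟩ ⟨ψ, rfl⟩
          exact ⟨φ + ψ, map_add _ _ _⟩
        zero_mem' := ⟨0, map_zero _⟩
        smul_mem' := by
          rintro h _ ⟨φ, rfl⟩
          exact ⟨_, (mul_contract hL h φ).symm⟩ }
    obtain ⟨φ, hφ⟩ : ∃ φ : Module.Dual k H, φ L ≠ 0 := by
      by_contra! h
      exact hL0 ((Module.forall_dual_apply_eq_zero_iff k L).1 h)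
    have hJ : J = ⊤ := hH.eq_top_of_counit_ne_zero J (x := contract L φ) ⟨φ, rfl⟩
      (by rwa [counit_contract])
    intro y
    exact (hJ ▸ Submodule.mem_top : y ∈ J)
  exact ⟨(LinearMap.injective_iff_surjective_of_finrank_eq_finrank
    (Subspace.dual_finrank_eq (K := k) (V := H))).2 hsurj, hsurj⟩

/-- A nonzero left integral together with a functional that takes the value one on it and spans the
left integrals. -/
lemma HasFixedVectors.exists_integral [IsCocomm k H] (hH : HasFixedVectors k H) :
    ∃ (L : H) (l : Module.Dual k H), L ≠ 0 ∧ (∀ h : H, h * L = counit (R := k) h • L) ∧ l L = 1 ∧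
      ∀ x : H, (∀ h : H, h * x = counit (R := k) h • x) → x = l x • L := by
  have : Nontrivial H := by
    refine ⟨⟨1, 0, fun h => ?_⟩⟩
    have := congrArg (counit (R := k)) h
    simp at this
  obtain ⟨L, hL0, hL⟩ := hH H
  simp only [smul_eq_mul] at hL
  obtain ⟨l, hl⟩ : ∃ l : Module.Dual k H, l L = 1 := by
    obtain ⟨φ, hφ⟩ : ∃ φ : Module.Dual k H, φ L ≠ 0 := by
      by_contra! h
      exact hL0 ((Module.forall_dual_apply_eq_zero_iff k L).1 h)
    exact ⟨(φ L)⁻¹ • φ, by simp [hφ]⟩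
  refine ⟨L, l, hL0, hL, hl, fun x hx => ?_⟩
  obtain ⟨hinj, hsurj⟩ := hH.contract_bijective hL0 hL
  obtain ⟨φ, rfl⟩ := hsurj x
  -- Injectivity of the contraction turns invariance of x into invariance of φ. Since S is an
  -- involution, φ is then a multiple of the counit, and the counit contracts L to L itself.
  have h1 : ∀ h : H, φ ∘ₗ LinearMap.mulLeft k (HopfAlgebra.antipode k h) =
      counit (R := k) h • φ := fun h => hinj (by rw [← mul_contract hL, hx, map_smul])
  have h2 : φ = φ 1 • counit (R := k) := by
    ext h
    have := LinearMap.congr_fun (h1 (HopfAlgebra.antipode k h)) 1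
    simpa [antipode_antipode, mul_comm] using this
  have h3 : contract L φ = φ 1 • L := by
    rw [h2, contract_apply (ℛ k L)]
    simp [mul_smul, ← Finset.smul_sum, Coalgebra.sum_counit_smul]
  rw [h3]
  simp [hl]

/-- A Frobenius functional. -/
lemma HasFixedVectors.exists_frobenius [IsCocomm k H] (hH : HasFixedVectors k H) :
    ∃ e : H ≃ₗ[k] Module.Dual k H, ∀ x y, e (x * y) = e y ∘ₗ LinearMap.mulRight k x := by
  obtain ⟨L, l, hL0, hL, hl, huniq⟩ := hH.exists_integral
  let B : H →ₗ[k] Module.Dual k H :=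
    { toFun := fun y => l ∘ₗ LinearMap.mulRight k y
      map_add' := fun y z => by ext; simp [mul_add]
      map_smul' := fun c y => by ext; simp }
  have hB : ∀ y h, B y h = l (h * y) := fun _ _ => rfl
  let K : Submodule H H :=
    { carrier := {y | B y = 0}
      add_mem' := fun {a b} ha hb => by
        change B (a + b) = 0
        rw [map_add, show B a = 0 from ha, show B b = 0 from hb, add_zero]
      zero_mem' := map_zero B
      smul_mem' := fun c y hy => by
        change B (c • y) = 0
        ext h
        have := LinearMap.congr_fun (show B y = 0 from hy) (h * c)
        simpa [hB, mul_assoc] using this }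
  -- A nonzero left ideal contains a nonzero fixed vector v = l(v) L, while membership in the kernel
  -- gives l(v) = 0.
  have hK : K = ⊥ := by
    by_contra h
    obtain ⟨v, hvK, hv, hfix⟩ := hH.exists_mem h
    refine hv ?_
    rw [huniq v hfix]
    have := LinearMap.congr_fun (show B v = 0 from hvK) 1
    rw [hB, one_mul] at this
    simp [this]
  have hinj : Function.Injective B := by
    rw [injective_iff_map_eq_zero]
    intro y hy
    exact (Submodule.mem_bot H).1 (hK ▸ (show y ∈ K from hy))
  refine ⟨LinearEquiv.ofBijective B ⟨hinj, (LinearMap.injective_iff_surjective_of_finrank_eq_finrank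
    (Subspace.dual_finrank_eq (K := k) (V := H)).symm).1 hinj⟩, fun x y => ?_⟩
  ext h
  change B (x * y) h = B y (h * x)
  rw [hB, hB, mul_assoc]

/-- Finite free modules are injective relative to finite-dimensional modules. -/
lemma HasFixedVectors.exists_retraction [IsCocomm k H] (hH : HasFixedVectors k H) {V : Type*}
    [AddCommGroup V] [Module k V] [Module H V] [IsScalarTower k H V] {r : ℕ}
    (j : (Fin r → H) →ₗ[H] V) (hj : Function.Injective j) :
    ∃ q : V →ₗ[H] (Fin r → H), q ∘ₗ j = LinearMap.id := by
  obtain ⟨e, he⟩ := hH.exists_frobenius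
  obtain ⟨q₀, hq₀⟩ := (j.restrictScalars k).exists_leftInverse_of_injective
    (LinearMap.ker_eq_bot.2 hj)
  have hq₀' : ∀ y, q₀ (j y) = y := fun y => LinearMap.congr_fun hq₀ y
  -- The Frobenius form makes H-linear maps V → H correspond to functionals on V, through evaluation
  -- of `e` at 1. `μ i` extends the functional of the i-th coordinate from H^r to V by means of the
  -- linear retraction `q₀`.
  let μ : Fin r → Module.Dual k V := fun i =>
    LinearMap.applyₗ (1 : H) ∘ₗ e.toLinearMap ∘ₗ LinearMap.proj i ∘ₗ q₀
  let ev : Fin r → V →ₗ[k] Module.Dual k H := fun i =>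
    { toFun := fun v => μ i ∘ₗ orbitMap k H v
      map_add' := fun v w => by ext; simp
      map_smul' := fun c v => by ext; simp [smul_comm _ c v] }
  have hev : ∀ i v h, ev i v h = μ i (h • v) := fun _ _ _ => rfl
  let q : V →ₗ[H] (Fin r → H) :=
    { toFun := fun v i => e.symm (ev i v)
      map_add' := fun v w => by ext; simp
      map_smul' := fun h v => by
        funext i
        rw [RingHom.id_apply, Pi.smul_apply, LinearEquiv.symm_apply_eq, smul_eq_mul, he,
          LinearEquiv.apply_symm_apply]
        ext x
        simp [hev, mul_smul] }
  refine ⟨q, LinearMap.ext fun y => funext fun i => ?_⟩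
  change e.symm (ev i (j y)) = y i
  rw [LinearEquiv.symm_apply_eq]
  ext h
  have h1 : e (h * y i) 1 = e (y i) h := by
    rw [he]; simp
  rw [hev, ← map_smul, ← h1]
  change e (q₀ (j (h • y)) i) 1 = _
  rw [hq₀']
  rfl

/-- A finite-dimensional module that contains a free submodule of codimension one is spanned by
a fixed vector and the free submodule. -/
lemma HasFixedVectors.exists_fixed_add_free [IsCocomm k H] (hH : HasFixedVectors k H) {V : Type u}
    [AddCommGroup V] [Module k V] [Module H V] [IsScalarTower k H V] [Module.Finite k V] {r : ℕ}
    (j : (Fin r → H) →ₗ[H] V) (hj : Function.Injective j)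
    (hV : Module.finrank k V = r * Module.finrank k H + 1) :
    ∃ w₀ : V, (∀ h : H, h • w₀ = counit (R := k) h • w₀) ∧ ∀ x : V, ∃ (c : k) (y : Fin r → H),
      x = c • w₀ + ∑ i, y i • j (Pi.single i 1) := by
  obtain ⟨q, hq⟩ := hH.exists_retraction j hj
  have hq' : ∀ y, q (j y) = y := fun y => LinearMap.congr_fun hq y
  have hdim : Module.finrank k (LinearMap.ker (q.restrictScalars k)) = 1 := by
    have h1 := LinearMap.finrank_range_add_finrank_ker (q.restrictScalars k)
    rw [LinearMap.range_eq_top.2 (show Function.Surjective (q.restrictScalars k) from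
      fun y => ⟨j y, hq' y⟩), finrank_top, Module.finrank_pi_fintype, hV] at h1
    simp only [Finset.sum_const, Finset.card_univ, Fintype.card_fin, smul_eq_mul] at h1
    omega
  have hne : LinearMap.ker q ≠ ⊥ := by
    intro h
    have h2 : LinearMap.ker (q.restrictScalars k) = ⊥ := by
      rw [LinearMap.ker_eq_bot]
      exact fun x y hxy => LinearMap.ker_eq_bot.1 h hxy
    rw [h2, finrank_bot] at hdim
    exact zero_ne_one hdim
  obtain ⟨w₀, hw₀, hw0, hfix⟩ := hH.exists_mem hne
  refine ⟨w₀, hfix, fun x => ?_⟩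
  have hx : x - j (q x) ∈ LinearMap.ker (q.restrictScalars k) := by
    simp [hq']
  obtain ⟨c, hc⟩ := (finrank_eq_one_iff_of_nonzero' (⟨w₀, hw₀⟩ :
    LinearMap.ker (q.restrictScalars k)) fun h => hw0 (congrArg Subtype.val h)).1 hdim ⟨_, hx⟩
  refine ⟨c, q x, ?_⟩
  have hc' : c • w₀ = x - j (q x) := congrArg Subtype.val hc
  have hj' : j (q x) = ∑ i, q x i • j (Pi.single i 1) := by
    have h2 : j = Fintype.linearCombination H fun i => j (Pi.single i 1) := by
      ext i
      simp
    conv_lhs => rw [h2]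
    rfl
  rw [hc', ← hj', sub_add_cancel]

/-- Finite-dimensional projective modules are free. -/
lemma HasFixedVectors.exists_equiv_free [IsCocomm k H] (hH : HasFixedVectors k H) {P : Type u}
    [AddCommGroup P] [Module k P] [Module H P] [IsScalarTower k H P] [Module.Finite k P]
    [Module.Projective H P] : ∃ r : ℕ, Nonempty (P ≃ₗ[H] (Fin r → H)) := by
  obtain ⟨L, l, hL0, hL, hl, huniq⟩ := hH.exists_integral
  -- The fixed vectors of H^r are L k^r, so the rank must be dim L P; the generators are preimages
  -- under L of a basis of L P.
  let R := LinearMap.range (Algebra.lsmul k k P L)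
  let b := Module.finBasis k R
  choose y hy using fun i => (b i).2
  have hy' : ∀ i, L • y i = b i := hy
  let j : (Fin (Module.finrank k R) → H) →ₗ[H] P := Fintype.linearCombination H y
  have hj : Function.Injective j := by
    rw [← LinearMap.ker_eq_bot]
    by_contra hne
    obtain ⟨v, hv, hv0, hfix⟩ := hH.exists_mem hne
    have hvi : ∀ i, v i = l (v i) • L := fun i =>
      huniq _ fun h => by simpa using congrFun (hfix h) i
    have h1 : ∑ i, l (v i) • (b i : P) = 0 := by
      rw [LinearMap.mem_ker] at hv
      rw [← hv]
      simp only [j, Fintype.linearCombination_apply]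
      refine Finset.sum_congr rfl fun i _ => ?_
      rw [← hy', ← smul_assoc, ← hvi]
    have h2 : ∑ i, l (v i) • b i = 0 := Subtype.ext (by simpa using h1)
    refine hv0 (funext fun i => ?_)
    rw [hvi, Fintype.linearIndependent_iff.1 b.linearIndependent _ h2 i, zero_smul, Pi.zero_apply]
  obtain ⟨q, hq⟩ := hH.exists_retraction j hj
  have hq' : ∀ y, q (j y) = y := fun y => LinearMap.congr_fun hq y
  have hLker : ∀ x, q x = 0 → L • x = 0 := by
    intro x hx
    have h1 : L • x ∈ LinearMap.range j := by
      have h2 := b.sum_repr ⟨L • x, ⟨x, rfl⟩⟩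
      have h3 := congrArg Subtype.val h2
      simp only [Submodule.coe_sum, Submodule.coe_smul] at h3
      rw [← h3]
      refine Submodule.sum_mem _ fun i _ => ?_
      rw [← hy', ← smul_assoc]
      refine Submodule.smul_mem _ _ ⟨Pi.single i 1, by simp [j]⟩
    obtain ⟨z, hz⟩ := h1
    have h4 : z = 0 := by
      rw [← hq' z, hz, map_smul, hx, smul_zero]
    rw [← hz, h4, map_zero]
  have hker : LinearMap.ker q = ⊥ := by
    by_contra hne
    obtain ⟨v, hv, hv0, hfix⟩ := hH.exists_mem hne
    -- Embedded in a free module, the fixed vector v has multiples of L as coordinates. Projecting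
    -- back gives v = L u, and L kills the component of u in ker q.
    obtain ⟨s, hs⟩ := Module.projective_def'.1 (inferInstance : Module.Projective H P)
    let w : P →₀ H := (s v).mapRange (fun x => algebraMap k H (l x)) (by simp)
    have hw : L • w = s v := by
      ext p
      have h1 : s v p = l (s v p) • L := huniq _ fun h => by
        have h2 := congrArg s (hfix h)
        rw [map_smul, ← smul_one_smul H (counit (R := k) h) v, map_smul, smul_one_smul] at h2
        simpa using DFunLike.congr_fun h2 p
      simp only [w, Finsupp.smul_apply, Finsupp.mapRange_apply, smul_eq_mul]
      rw [h1]
      simp [hl, Algebra.algebraMap_eq_smul_one]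
    have hv1 : v = L • (Finsupp.linearCombination H id w) := by
      rw [← map_smul, hw]
      exact (LinearMap.congr_fun hs v).symm
    set u := Finsupp.linearCombination H id w
    have h3 : L • (u - j (q u)) = 0 := hLker _ (by simp [hq'])
    rw [smul_sub, ← map_smul j, ← map_smul q, ← hv1, LinearMap.mem_ker.1 hv, map_zero,
      sub_zero] at h3
    exact hv0 h3
  exact ⟨_, ⟨LinearEquiv.ofBijective q ⟨LinearMap.ker_eq_bot.1 hker, fun y => ⟨j y, hq' y⟩⟩⟩⟩

end Frobenius

/-! ## Endotrivial modules -/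

instance TrivialMod.instModuleBase (k : Type u) (H : Type v) [Field k] [Ring H]
    [HopfAlgebra k H] : Module k (TrivialMod k H) := inferInstanceAs (Module k k)

instance TrivialMod.instIsScalarTower (k : Type u) (H : Type v) [Field k] [Ring H]
    [HopfAlgebra k H] : IsScalarTower k H (TrivialMod k H) where
  smul_assoc c h x := by
    change (counit (R := k) (c • h) * (show k from x) : k) = c * (counit (R := k) h * (show k from x))
    rw [map_smul, smul_eq_mul, mul_assoc]

/-! ### Rigidity: comparison of M and N through their Hom spaces. -/

section Rigidity

variable {k H : Type u} [Field k] [Ring H] [HopfAlgebra k H] [Module.Finite k H] [IsCocomm k H]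

/-- The endomorphisms of an endotrivial module contain a free submodule of codimension one. -/
lemma IsEndotrivial.exists_free (hH : HasFixedVectors k H) {M : Type u} [AddCommGroup M]
    [Module k M] [Module H M] [IsScalarTower k H M] (hM : IsEndotrivial k H M) :
    ∃ (r : ℕ) (j : (Fin r → H) →ₗ[H] HomMod k H M M), Function.Injective j ∧
      Module.finrank k M * Module.finrank k M = r * Module.finrank k H + 1 := by
  obtain ⟨hfin, P, _, _, hP, ⟨e⟩⟩ := hM
  let _ : Module k P := Module.compHom P (algebraMap k H)
  have : IsScalarTower k H P := ⟨fun c h x => by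
    rw [Algebra.smul_def, mul_smul]; rfl⟩
  let ek : HomMod k H M M ≃ₗ[k] TrivialMod k H × P := e.restrictScalars k
  have : Module.Finite k (TrivialMod k H) := inferInstanceAs (Module.Finite k k)
  have : Module.Finite k P := Module.Finite.of_surjective
    (LinearMap.snd k (TrivialMod k H) P ∘ₗ ek.toLinearMap)
    fun x => ⟨ek.symm (0, x), by simp⟩
  obtain ⟨r, ⟨f⟩⟩ := hH.exists_equiv_free (P := P)
  refine ⟨r, e.symm.toLinearMap ∘ₗ LinearMap.inr H _ P ∘ₗ f.symm.toLinearMap,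
    e.symm.injective.comp (LinearMap.inr_injective.comp f.symm.injective), ?_⟩
  have h1 : Module.finrank k (HomMod k H M M) = Module.finrank k M * Module.finrank k M :=
    Module.finrank_linearMap k k M M
  have h2 : Module.finrank k (TrivialMod k H) = 1 := Module.finrank_self k
  rw [← h1, ek.finrank_eq, Module.finrank_prod, h2, (f.restrictScalars k).finrank_eq,
    Module.finrank_pi_fintype]
  simp [add_comm]

/-- If `Hom_k(M, M)` and `Hom_k(M, N)` both contain a free submodule of codimension one and `M`
and `N` have the same dimension, then they are isomorphic. -/
lemma HasFixedVectors.nonempty_equiv (hH : HasFixedVectors k H) {M N : Type u} [AddCommGroup M]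
    [Module k M] [Module H M] [IsScalarTower k H M] [AddCommGroup N] [Module k N] [Module H N]
    [IsScalarTower k H N] [Module.Finite k M] [Module.Finite k N]
    (hMN : Module.finrank k N = Module.finrank k M) {r : ℕ}
    (hr : Module.finrank k M * Module.finrank k M = r * Module.finrank k H + 1)
    (jM : (Fin r → H) →ₗ[H] HomMod k H M M) (hjM : Function.Injective jM)
    (jN : (Fin r → H) →ₗ[H] HomMod k H M N) (hjN : Function.Injective jN) :
    Nonempty (N ≃ₗ[H] M) := by
  have hWM : Module.finrank k (HomMod k H M M) = r * Module.finrank k H + 1 :=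
    (Module.finrank_linearMap k k M M).trans hr
  have hWN : Module.finrank k (HomMod k H M N) = r * Module.finrank k H + 1 :=
    (Module.finrank_linearMap k k M N).trans (by rw [hMN, hr])
  obtain ⟨m₀, hm₀, hm⟩ := hH.exists_fixed_add_free jM hjM hWM
  obtain ⟨n₀, hn₀, hn⟩ := hH.exists_fixed_add_free jN hjN hWN
  -- Both tensor products acquire the same free summand, of rank r · dim M, which is then cancelled.
  obtain ⟨e₁⟩ := tensMod_equiv_prod_free (M := N) m₀ hm₀ _ hm hWM hMN
  obtain ⟨e₂⟩ := tensMod_equiv_prod_free (M := M) n₀ hn₀ _ hn hWN rfl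
  exact hH.cancel (e₁.symm ≪≫ₗ homTensSwap ≪≫ₗ e₂)

end Rigidity

/-! ## Openness -/

/-- The determinant of a linear family of endomorphisms is a polynomial in the parameters. -/
lemma exists_eval_eq_det {k σ U : Type*} [Field k] [Fintype σ] [AddCommGroup U] [Module k U]
    [Module.Finite k U] (Γ : (σ → k) →ₗ[k] Module.End k U) :
    ∃ f : MvPolynomial σ k, ∀ x, MvPolynomial.eval x f = LinearMap.det (Γ x) := by
  classical
  let b := Module.finBasis k U
  refine ⟨Matrix.det (∑ s, (MvPolynomial.X s : MvPolynomial σ k) •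
    (LinearMap.toMatrix b b (Γ (Pi.single s 1))).map MvPolynomial.C), fun x => ?_⟩
  rw [RingHom.map_det, ← LinearMap.det_toMatrix b]
  congr 1
  have hx : Γ x = ∑ s, x s • Γ (Pi.single s 1) := by
    conv_lhs => rw [pi_eq_sum_univ' x]
    simp [map_sum]
  ext i l
  rw [hx]
  simp [Matrix.sum_apply, map_sum]

/-- The structure constants of a module with respect to bases of the algebra and the module. -/
noncomputable def actCoords {k H N ι κ : Type*} [Field k] [Ring H] [Algebra k H] [AddCommGroup N] [Module k N]
    [Module H N] (a : Module.Basis ι k H) (b : Module.Basis κ k N) : ι × κ × κ → k :=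
  -- The triple is algebra index, row, column.
  fun s => b.repr (a s.1 • b s.2.2) s.2.1

section Openness

variable {k H : Type u} [Field k] [Ring H] [HopfAlgebra k H]

/-- The linear map from `H` to the endomorphisms of `M` with prescribed structure constants. -/
noncomputable def mapOfCoords {M ι κ : Type*} [Fintype κ] [DecidableEq κ] [AddCommGroup M]
    [Module k M] (a : Module.Basis ι k H) (b : Module.Basis κ k M) :
    (ι × κ × κ → k) →ₗ[k] (H →ₗ[k] Module.End k M) where
  toFun x := a.constr k fun s => Matrix.toLin b b (Matrix.of fun i l => x (s, i, l))
  map_add' x y := by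
    refine a.ext fun s => ?_
    rw [LinearMap.add_apply, Module.Basis.constr_basis, Module.Basis.constr_basis,
      Module.Basis.constr_basis, ← map_add]
    rfl
  map_smul' c x := by
    refine a.ext fun s => ?_
    rw [RingHom.id_apply, LinearMap.smul_apply, Module.Basis.constr_basis,
      Module.Basis.constr_basis, ← map_smul]
    rfl

/-- `mapOfCoords` is linear on the whole affine space, including arrays that define no action. At
the structure constants of a module N it is the action of N carried to M by the bijection of bases.
-/
lemma mapOfCoords_actCoords {M N ι κ : Type*} [Fintype κ] [DecidableEq κ] [AddCommGroup M]
    [Module k M] [AddCommGroup N] [Module k N] [Module H N] [IsScalarTower k H N]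
    (a : Module.Basis ι k H) (b : Module.Basis κ k M) (c : Module.Basis κ k N) (h : H) (m : M) :
    b.equiv c (Equiv.refl κ) (mapOfCoords a b (actCoords a c) h m) =
      h • b.equiv c (Equiv.refl κ) m := by
  have key : (b.equiv c (Equiv.refl κ)).toLinearMap.compRight k ∘ₗ
      mapOfCoords a b (actCoords a c) =
      ((b.equiv c (Equiv.refl κ)).toLinearMap.lcomp k N) ∘ₗ (Algebra.lsmul k k N).toLinearMap := by
    refine a.ext fun s => b.ext fun l => ?_
    have h1 : mapOfCoords a b (actCoords a c) (a s) =
        Matrix.toLin b b (Matrix.of fun i l => actCoords a c (s, i, l)) :=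
      a.constr_basis k _ s
    simp only [LinearMap.comp_apply, LinearMap.compRight_apply, h1, Matrix.toLin_self, map_sum,
      map_smul, LinearMap.lcomp_apply, LinearEquiv.coe_coe, Module.Basis.equiv_apply,
      Equiv.refl_apply, Matrix.of_apply, actCoords]
    exact c.sum_repr _
  exact LinearMap.congr_fun (LinearMap.congr_fun key h) m

/-- The map `ρ ↦ (h ↦ ∑ ρ(h₍₁₎) ∘ f ∘ S(h₍₂₎))`. -/
noncomputable def twist {M : Type*} [AddCommGroup M] [Module k M] [Module H M] [IsScalarTower k H M]
    (f : Module.End k M) : (H →ₗ[k] Module.End k M) →ₗ[k] (H →ₗ[k] Module.End k M) where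
  toFun ρ := LinearMap.mul' k (Module.End k M) ∘ₗ TensorProduct.map ρ
    (LinearMap.mulLeft k f ∘ₗ (Algebra.lsmul k k M).toLinearMap ∘ₗ
      HopfAlgebra.antipode k (A := H)) ∘ₗ comul
  map_add' ρ ρ' := by
    rw [TensorProduct.map_add_left, LinearMap.add_comp, LinearMap.comp_add]
  map_smul' c ρ := by
    rw [TensorProduct.map_smul_left, LinearMap.smul_comp, LinearMap.comp_smul, RingHom.id_apply]

lemma twist_apply {M : Type*} [AddCommGroup M] [Module k M] [Module H M] [IsScalarTower k H M]
    (f : Module.End k M) (ρ : H →ₗ[k] Module.End k M) {ι : Type*} {h : H}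
    (r : Coalgebra.Repr k h ι) (m : M) :
    twist f ρ h m = ∑ i ∈ r.index,
      ρ (r.left i) (f (HopfAlgebra.antipode k (r.right i) • m)) := by
  simp only [twist, LinearMap.coe_mk, AddHom.coe_mk, LinearMap.comp_apply]
  rw [← r.eq]
  simp [map_sum, LinearMap.sum_apply]

/-- Only the action on the target varies, while the antipode acts through the fixed M. Hence the
action of h on a fixed map in Hom_k(M, N) is linear in the structure constants of N. -/
lemma twist_mapOfCoords {M N : Type u} {ι κ : Type*} [Fintype κ] [DecidableEq κ] [AddCommGroup M]
    [Module k M] [Module H M] [IsScalarTower k H M] [AddCommGroup N] [Module k N] [Module H N]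
    [IsScalarTower k H N] (a : Module.Basis ι k H) (b : Module.Basis κ k M)
    (c : Module.Basis κ k N) (f : Module.End k M) (h : H) :
    HomMod.lof k H M N ((b.equiv c (Equiv.refl κ)).toLinearMap ∘ₗ
        twist f (mapOfCoords a b (actCoords a c)) h) =
      h • HomMod.lof k H M N ((b.equiv c (Equiv.refl κ)).toLinearMap ∘ₗ f) := by
  refine (HomMod.lof k H M N).symm.injective (LinearMap.ext fun m => ?_)
  rw [HomMod.lof_symm_smul _ _ _ _ (ℛ k h)]
  simp only [LinearEquiv.symm_apply_apply, LinearMap.comp_apply, twist_apply f _ (ℛ k h),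
    map_sum, LinearEquiv.coe_coe, mapOfCoords_actCoords]

variable [Module.Finite k H] [IsCocomm k H]

/-- The isomorphism class of an endotrivial module contains a nonempty principal open subset of the
space of structure constants. -/
lemma IsEndotrivial.exists_polynomial (hH : HasFixedVectors k H) {M : Type u} [AddCommGroup M]
    [Module k M] [Module H M] [IsScalarTower k H M] (hM : IsEndotrivial k H M) {ι κ : Type*}
    [Finite ι] [Finite κ] (a : Module.Basis ι k H) (b : Module.Basis κ k M) :
    ∃ f : MvPolynomial (ι × κ × κ) k, MvPolynomial.eval (actCoords a b) f ≠ 0 ∧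
      ∀ (N : Type u) [AddCommGroup N] [Module k N] [Module H N] [IsScalarTower k H N]
        (c : Module.Basis κ k N), MvPolynomial.eval (actCoords a c) f ≠ 0 →
          Nonempty (N ≃ₗ[H] M) := by
  classical
  cases nonempty_fintype ι
  cases nonempty_fintype κ
  obtain ⟨r, j, hj, hr⟩ := hM.exists_free hH
  have : Module.Finite k M := hM.1
  obtain ⟨π, hπ⟩ := (j.restrictScalars k).exists_leftInverse_of_injective
    (LinearMap.ker_eq_bot.2 hj)
  let F : Fin r → Module.End k M := fun i => (HomMod.lof k H M M).symm (j (Pi.single i 1))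
  have hjF : ∀ y, j y = ∑ i, y i • HomMod.lof k H M M (F i) := by
    have h2 : j = Fintype.linearCombination H fun i => HomMod.lof k H M M (F i) := by
      ext i
      simp [F]
    intro y
    conv_lhs => rw [h2]
    rfl
  -- At the point of N, `Γ` is (yᵢ) ↦ ∑ yᵢ • (T ∘ Fᵢ) followed by the fixed linear map `π` (after
  -- identifying N with M). It is the identity at M, and a nonzero determinant at N forces
  -- injectivity of `jN`.
  let Γ : (ι × κ × κ → k) →ₗ[k] Module.End k (Fin r → H) :=
    ∑ i, (LinearMap.lcomp k (Fin r → H) (LinearMap.proj i : (Fin r → H) →ₗ[k] H)) ∘ₗ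
      (LinearMap.compRight k (π ∘ₗ (HomMod.lof k H M M).toLinearMap)) ∘ₗ
        twist (F i) ∘ₗ mapOfCoords a b
  have hΓ : ∀ x y, Γ x y = π (HomMod.lof k H M M (∑ i, twist (F i) (mapOfCoords a b x) (y i))) := by
    intro x y
    simp [Γ, LinearMap.sum_apply, map_sum]
  obtain ⟨f, hf⟩ := exists_eval_eq_det Γ
  refine ⟨f, ?_, fun N _ _ _ _ c hc => ?_⟩
  · have h1 : Γ (actCoords a b) = LinearMap.id := by
      refine LinearMap.ext fun y => ?_
      rw [hΓ, map_sum]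
      have h2 : ∀ i, HomMod.lof k H M M (twist (F i) (mapOfCoords a b (actCoords a b)) (y i)) =
          y i • HomMod.lof k H M M (F i) := by
        intro i
        have := twist_mapOfCoords a b b (F i) (y i)
        rw [Module.Basis.equiv_refl] at this
        exact this
      rw [Finset.sum_congr rfl fun i _ => h2 i, ← hjF]
      exact LinearMap.congr_fun hπ y
    rw [hf, h1, LinearMap.det_id]
    exact one_ne_zero
  · have : Module.Finite k N := Module.Finite.of_basis c
    let T := b.equiv c (Equiv.refl κ)
    let jN : (Fin r → H) →ₗ[H] HomMod k H M N :=
      Fintype.linearCombination H fun i => HomMod.lof k H M N (T.toLinearMap ∘ₗ F i)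
    refine hH.nonempty_equiv T.finrank_eq.symm hr j hj jN ?_
    rw [injective_iff_map_eq_zero]
    intro y hy
    have h1 : T.toLinearMap ∘ₗ (∑ i, twist (F i) (mapOfCoords a b (actCoords a c)) (y i)) = 0 := by
      refine (HomMod.lof k H M N).injective ?_
      rw [map_zero, ← hy]
      have h2 : T.toLinearMap ∘ₗ (∑ i, twist (F i) (mapOfCoords a b (actCoords a c)) (y i)) =
          ∑ i, T.toLinearMap ∘ₗ twist (F i) (mapOfCoords a b (actCoords a c)) (y i) := by
        ext m
        simp [LinearMap.sum_apply]
      rw [h2, map_sum]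
      exact Finset.sum_congr rfl fun i _ => twist_mapOfCoords a b c (F i) (y i)
    have h2 : (∑ i, twist (F i) (mapOfCoords a b (actCoords a c)) (y i)) = 0 :=
      LinearMap.ext fun m => T.injective (by simpa using LinearMap.congr_fun h1 m)
    have h3 : Γ (actCoords a c) y = 0 := by
      rw [hΓ, h2, map_zero, map_zero]
    rw [hf] at hc
    have h4 := (LinearMap.equivOfDetNeZero _ hc).injective
    exact (injective_iff_map_eq_zero _).1 h4 _ h3

/-- There are finitely many endotrivial modules of given dimension. -/
lemma HasFixedVectors.finite_endotrivial (hH : HasFixedVectors k H) (n : ℕ) :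
    ∃ (m : ℕ) (N : Fin m → ModuleCat.{u} H),
      ∀ (M : Type u) [AddCommGroup M] [Module k M] [Module H M] [IsScalarTower k H M],
        IsEndotrivial k H M → Module.finrank k M = n → ∃ i : Fin m, Nonempty (M ≃ₗ[H] N i) := by
  let a := Module.finBasis k H
  let R := MvPolynomial (Fin (Module.finrank k H) × Fin n × Fin n) k
  -- Polynomials whose nonvanishing locus contains modules of at most one isomorphism class.
  let S : Set R := {f | ∃ M₀ : ModuleCat.{u} H, ∀ (N : Type u) [AddCommGroup N] [Module k N]
    [Module H N] [IsScalarTower k H N] (c : Module.Basis (Fin n) k N),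
      MvPolynomial.eval (actCoords a c) f ≠ 0 → Nonempty (N ≃ₗ[H] M₀)}
  obtain ⟨T, hTS, hT⟩ := (Submodule.fg_span_iff_fg_span_finset_subset S).1
    (IsNoetherian.noetherian (Submodule.span R S))
  choose N hN using fun t : T => hTS t.2
  refine ⟨T.card, fun i => N (T.equivFin.symm i), fun M _ _ _ _ hM hn => ?_⟩
  have : Module.Finite k M := hM.1
  let b := Module.finBasisOfFinrankEq k M hn
  obtain ⟨f, hf, hfN⟩ := hM.exists_polynomial hH a b
  have hfT : f ∈ Ideal.span (T : Set R) :=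
    hT.le (Submodule.subset_span (show f ∈ S from ⟨ModuleCat.of H M, hfN⟩))
  -- If all the generators in `T` vanished at the point of M, so would every element of their ideal,
  -- including f.
  obtain ⟨t, ht, htf⟩ : ∃ t ∈ T, MvPolynomial.eval (actCoords a b) t ≠ 0 := by
    by_contra! h
    exact hf (RingHom.mem_ker.1 ((Ideal.span_le (I := RingHom.ker _)).2
      (fun t ht => RingHom.mem_ker.2 (h t ht)) hfT))
  refine ⟨T.equivFin ⟨t, ht⟩, ?_⟩
  beta_reduce
  rw [Equiv.symm_apply_apply]
  exact hN ⟨t, ht⟩ M b htf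

end Openness

end FinGroupScheme

theorem theorem3p5 (p : ℕ) [Fact p.Prime] (k : Type u) [Field k] [IsAlgClosed k] [CharP k p]
    (G : Scheme.{u}) [G.Over (Spec (.of k))] [GrpObj (G.asOver (Spec (.of k)))]
    [IsAffine G] [Module.Finite k (CoordRing k G)] (hG : IsUnipotent k G)
    (n : ℕ) (hn : 0 < n) :
    ∃ (m : ℕ) (N : Fin m → ModuleCat.{u} (GroupSchemeAlg k G)),
      ∀ (M : Type u) [AddCommGroup M] [Module k M] [Module (GroupSchemeAlg k G) M]
        [IsScalarTower k (GroupSchemeAlg k G) M],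
        IsEndotrivial k (GroupSchemeAlg k G) M → Module.finrank k M = n →
          ∃ i : Fin m, Nonempty (M ≃ₗ[GroupSchemeAlg k G] N i) := by
  -- `IsUnipotent` unfolds to `HasFixedVectors` for the group algebra.
  exact HasFixedVectors.finite_endotrivial (H := GroupSchemeAlg k G) hG n
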